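/- For each sample size $n$ let $y=X\beta^*+\varepsilon\in\mathbb R^n$, where $X$ is a nonrandom $n\times p$ matrix with columns $x_{(j)}$ satisfying $x_{(j)}^Tx_{(j)}/n=1$; $p,X,\beta^*$ and all quantities below may depend on $n$ unless they are called constants, and all conditions need hold only for large $n$. Let $A_0=\{j:\beta^*_j\ne0\}$, $q=|A_0|\ge1$, $d_*=\min_{j\in A_0}|\beta_j^*|$. Given a penalty $p_\lambda$, write $J_\lambda(|t|)=p_\lambda(|t|)-\lambda|t|$, let $\nabla J_\lambda(|t|)$ be the derivative of $t\mapsto J_\lambda(|t|)$, and put $$Q(\beta\mid\beta^{(0)},\lambda)=\frac1{2n}\|y-X\beta\|^2+\sum_{j=1}^p\nabla J_\lambda(|\beta^{(0)}_j|)\,\beta_j+\lambda\sum_{j=1}^p|\beta_j| .$$ For $\tau>0$ the calibrated CCCP path $\{\widehat\beta(\lambda):\lambda>0\}$ is given by $\widehat\beta^{(1)}(\lambda)\in\arg\min_\beta Q(\beta\mid 0,\tau\lambda)$ and $\widehat\beta(\lambda)\in\arg\min_\beta Q(\beta\mid\widehat\beta^{(1)}(\lambda),\lambda)$ (any choice of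 minimizers). Let $M_\lambda=\{j:\widehat\beta_j(\lambda)\neq0\}$ and $$\mathrm{HBIC}(\lambda)=\log\bigl(n^{-1}\|y-X\widehat\beta(\lambda)\|^2\bigr)+|M_\lambda|\frac{C_n\log p}{n},\qquad \Lambda_n=\{\lambda>0:|M_\lambda|\le K_n\},$$ where $K_n>q$ is an integer, and let $\widehat\lambda$ denote a minimizer of $\mathrm{HBIC}$ over $\Lambda_n$. Assume: (A1) $\lambda_{\min}(n^{-1}X_{A_0}^TX_{A_0})\ge C_1$ for a constant $C_1>0$. (A2) $\varepsilon_1,\dots,\varepsilon_n$ are i.i.d. with mean zero and $E[e^{t\varepsilon_i}]\le e^{\sigma^2t^2/2}$ for all $t\in\mathbb R$, for a constant $0<\sigma<\infty$; and their variance is at least $v$ for a constant $v>0$ (if the error distribution does not depend on $n$, this only says that it is non-degenerate). (A3) For every $\lambda>0$, $p_\lambda$ is nondecreasing and concave on $[0,\infty)$ with continuous derivative on $(0,\infty)$; $t\mapsto J_\lambda(|t|)$ is a differentiable concave function on $\mathbb R$; $\nabla J_\lambda(|t|)=-\lambda\,\mathrm{sign}(t)$ for $|t|>a\lambda$, and $|\nabla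 J_\lambda(|t|)|\le|t|$ for $|t|\le b\lambda$, with constants $a>1$ and $0<b\le a$. (A4) $\gamma=\min\bigl\{\|X\delta\|/(\sqrt n\,\|\delta_{A_0}\|):\delta\ne0,\ \|\delta_{A_0^c}\|_1\le3\|\delta_{A_0}\|_1\bigr\}>0$. (A5) $\tau=\tau_n\to0$, and there are $\lambda_n>0$ with $\lambda_n=o(d_*)$, $n\tau_n^2\lambda_n^2\to\infty$, $\log p=o(n\tau_n^2\lambda_n^2)$ and $\tau_n\gamma^{-2}q=o(1)$. Assume also that for some constant $\kappa>0$ $$\liminf_{n\to\infty}\ \min_{A\not\supseteq A_0,\ |A|\le K_n} n^{-1}\|(I_n-P_A)X_{A_0}\beta^*_{A_0}\|^2\ \ge\ \kappa ,$$ where $P_A$ is the orthogonal projection onto the span of the columns of $X$ with index in $A$. If $p\to\infty$, $C_n\to\infty$, $qC_n\log p=o(n)$ and $K_n^2\log p\,\log n=o(n)$, then, with probability tending to $1$ as $n\to\infty$, $\mathrm{HBIC}$ attains its minimum over $\Lambda_n$ and every minimizer $\widehat\lambda$ satisfies $M_{\widehat\lambda}=A_0$; in particular $P(M_{\widehat\lambda}=A_0)\to1$.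 -/

import Mathlib

open Filter Topology MeasureTheory ProbabilityTheory Asymptotics
open scoped Matrix NNReal ENNReal

noncomputable section

namespace HBIC

/-- The index set of the nonzero coordinates of a coefficient vector. -/
def supp {p : ℕ} (β : Fin p → ℝ) : Finset (Fin p) :=
  Finset.univ.filter (fun j => β j ≠ 0)

/-- The Euclidean norm of a coordinate vector. -/
def l2norm {ι : Type*} [Fintype ι] (v : ι → ℝ) : ℝ := ‖WithLp.toLp 2 v‖

/-- The submatrix `X_A` formed by the columns with index in `A`. -/
def subCols {n p : ℕ} (X : Matrix (Fin n) (Fin p) ℝ) (A : Finset (Fin p)) :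
    Matrix (Fin n) A ℝ :=
  X.submatrix id (fun j : A => (j : Fin p))

/-- The smallest eigenvalue of a real symmetric matrix. -/
def lambdaMin {ι : Type*} [Fintype ι] [DecidableEq ι] (B : Matrix ι ι ℝ) : ℝ :=
  sInf (spectrum ℝ B)

/-- The linear space spanned by the columns of `X_A`. -/
def colSpace {n p : ℕ} (X : Matrix (Fin n) (Fin p) ℝ) (A : Finset (Fin p)) :
    Submodule ℝ (EuclideanSpace ℝ (Fin n)) :=
  Submodule.span ℝ (Set.range fun j : A => WithLp.toLp 2 ((subCols X A).col j))

/-- `n⁻¹ ‖(I - P_A) X_{A₀} β_{A₀}‖²`, with `A₀` the support of `β` and `P_A` the orthogonal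
projection onto the span of the columns of `X_A`. -/
def misfit {n p : ℕ} (X : Matrix (Fin n) (Fin p) ℝ) (β : Fin p → ℝ) (A : Finset (Fin p)) : ℝ :=
  let μ : EuclideanSpace ℝ (Fin n) :=
    WithLp.toLp 2 (subCols X (supp β) *ᵥ fun j : supp β => β j)
  ‖μ - (colSpace X A).starProjection μ‖ ^ 2 / n

/-- The minimal signal `d_*`: the least absolute value of a nonzero coefficient. -/
def minSignal {p : ℕ} (β : Fin p → ℝ) : ℝ :=
  sInf ((fun j => |β j|) '' {j | β j ≠ 0})

/-- The restricted eigenvalue constant `γ` of the design `X` over the cone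
`‖δ_{Aᶜ}‖₁ ≤ 3 ‖δ_A‖₁`, `δ ≠ 0`. -/
def restrictedEigenvalue {n p : ℕ} (X : Matrix (Fin n) (Fin p) ℝ) (A : Finset (Fin p)) : ℝ :=
  sInf ((fun δ : Fin p → ℝ => l2norm (X *ᵥ δ) / (√n * l2norm (fun j : A => δ j))) ''
    {δ | δ ≠ 0 ∧ ∑ j ∈ Aᶜ, |δ j| ≤ 3 * ∑ j ∈ A, |δ j|})

/-- The function `t ↦ J_λ(|t|)` in the decomposition `p_λ(|t|) = J_λ(|t|) + λ|t|`. -/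
def concavePart (pen : ℝ → ℝ → ℝ) (l t : ℝ) : ℝ := pen l |t| - l * |t|

/-- The conditions on the family of penalties `pen l = p_λ` (`l = λ`), with constants `a`, `b`. -/
structure PenaltyCondition (pen : ℝ → ℝ → ℝ) (a b : ℝ) : Prop where
  one_lt_a : 1 < a
  b_pos : 0 < b
  b_le_a : b ≤ a
  monotone : ∀ l, 0 < l → MonotoneOn (pen l) (Set.Ici 0)
  concave : ∀ l, 0 < l → ConcaveOn ℝ (Set.Ici 0) (pen l)
  differentiable : ∀ l, 0 < l → DifferentiableOn ℝ (pen l) (Set.Ioi 0)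
  deriv_continuous : ∀ l, 0 < l → ContinuousOn (deriv (pen l)) (Set.Ioi 0)
  concavePart_differentiable : ∀ l, 0 < l → Differentiable ℝ (concavePart pen l)
  concavePart_concave : ∀ l, 0 < l → ConcaveOn ℝ Set.univ (concavePart pen l)
  deriv_large : ∀ l, 0 < l → ∀ t, a * l < |t| →
    deriv (concavePart pen l) t = -l * Real.sign t
  deriv_small : ∀ l, 0 < l → ∀ t, |t| ≤ b * l → |deriv (concavePart pen l) t| ≤ |t|

/-- The residual sum of squares `‖y - Xβ‖²`. -/
def sse {n p : ℕ} (X : Matrix (Fin n) (Fin p) ℝ) (y : Fin n → ℝ) (β : Fin p → ℝ) : ℝ :=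
  l2norm (y - X *ᵥ β) ^ 2

/-- The tight convex upper bound `Q(β ∣ β₀, l)` of the penalized least squares objective. -/
def Q {n p : ℕ} (pen : ℝ → ℝ → ℝ) (X : Matrix (Fin n) (Fin p) ℝ) (y : Fin n → ℝ)
    (β₀ : Fin p → ℝ) (l : ℝ) (β : Fin p → ℝ) : ℝ :=
  1 / (2 * n) * sse X y β + ∑ j, deriv (concavePart pen l) (β₀ j) * β j + l * ∑ j, |β j|

/-- `path` is a calibrated CCCP solution path: for each `l > 0`, `path l` minimizes
`Q(· ∣ β₁, l)` for some minimizer `β₁` of `Q(· ∣ 0, τ l)`. -/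
def IsCalibratedPath {n p : ℕ} (pen : ℝ → ℝ → ℝ) (τ : ℝ) (X : Matrix (Fin n) (Fin p) ℝ)
    (y : Fin n → ℝ) (path : ℝ → Fin p → ℝ) : Prop :=
  ∀ l, 0 < l → ∃ β₁ : Fin p → ℝ,
    IsMinOn (Q pen X y 0 (τ * l)) Set.univ β₁ ∧
    IsMinOn (Q pen X y β₁ l) Set.univ (path l)

/-- The high-dimensional BIC of a fitted coefficient vector. -/
def hbic {n p : ℕ} (C : ℝ) (X : Matrix (Fin n) (Fin p) ℝ) (y : Fin n → ℝ)
    (β : Fin p → ℝ) : ℝ :=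
  Real.log (sse X y β / n) + (supp β).card * (C * Real.log p / n)

/-- The candidate tuning parameters: those `l > 0` whose fitted model has at most `K` covariates. -/
def tuningSet {p : ℕ} (K : ℕ) (path : ℝ → Fin p → ℝ) : Set ℝ :=
  {l | 0 < l ∧ (supp (path l)).card ≤ K}

/-- `l` is a minimizer of the HBIC along the path over the candidate tuning parameters. -/
def IsHBICChoice {n p : ℕ} (C : ℝ) (K : ℕ) (X : Matrix (Fin n) (Fin p) ℝ) (y : Fin n → ℝ)
    (path : ℝ → Fin p → ℝ) (l : ℝ) : Prop :=
  l ∈ tuningSet K path ∧ IsMinOn (fun l' => hbic C X y (path l')) (tuningSet K path) l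

end HBIC

end

namespace HBIC

open scoped RealInnerProductSpace

/-! The proof exhibits one good competitor and then compares every other candidate with it. Outside
four exceptional noise events of vanishing probability the whole argument is deterministic, so no
measurability of the path or of the selected `λ` is needed.

The competitor is `λ_n`. If every noise correlation `⟪x j, ε⟫` is at most `n τ λ_n / 2`, the first
CCCP step, a Lasso at level `τ λ_n`, has sup-norm error at most a small multiple of `λ_n`. The
second step then has weights that cancel the penalty on `A₀` and barely relax it elsewhere, so least
squares on `A₀` is its only minimizer (`cccp_oracle`, `path_oracle`). As `q < K_n`, this fit belongs
to a candidate tuning parameter.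

A candidate with model `A₀` cannot have a smaller residual sum of squares than least squares. If its
model strictly contains `A₀`, the residual sum of squares drops by at most the squared projection of
the noise on the added directions, of order `log p` per added variable; since `C_n → ∞`, the HBIC
penalty outweighs the resulting gain in the logarithm. If its model misses part of `A₀`, the
residual sum of squares exceeds `‖ε‖²` by a fixed multiple of `n`; the logarithm rises by a
constant, while the oracle's penalty `q C_n log p / n` tends to zero. So `λ_n` is itself a
minimizer, and every minimizer has model `A₀` (`hbic_selects_of_events`).

The noise bounds must hold for all models at once. The projection on a `d`-dimensional space
satisfies `E exp(‖P ε‖² / (4σ²)) ≤ 2 ^ d`, and a union bound over all subsets is summed by the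
binomial theorem. Chebyshev's inequality keeps `‖ε‖² / n` between positive constants. -/

/-! ### Exponential moments of sub-Gaussian projections by Gaussian randomization -/

/-- The integral is `√2`; rounding it up to `2` gives the factor `2` per dimension in the tail
bounds. -/
lemma integrable_exp_sq_gaussianReal :
    Integrable (fun g : ℝ => Real.exp (g ^ 2 / 4)) (gaussianReal 0 1) ∧
      ∫ g, Real.exp (g ^ 2 / 4) ∂(gaussianReal 0 1) ≤ 2 := by
  have hpdf : ∀ g : ℝ, gaussianPDFReal 0 1 g • Real.exp (g ^ 2 / 4)
      = (√(2 * Real.pi))⁻¹ * Real.exp (-(1 / 4) * g ^ 2) := by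
    intro g
    rw [gaussianPDFReal, smul_eq_mul, mul_assoc, ← Real.exp_add]
    simp only [NNReal.coe_one, mul_one, sub_zero]
    congr 2
    ring
  constructor
  · rw [gaussianReal_of_var_ne_zero _ one_ne_zero, gaussianPDF_def,
      integrable_withDensity_iff_integrable_smul' (by fun_prop) (by simp)]
    simp only [ENNReal.toReal_ofReal (gaussianPDFReal_nonneg 0 1 _), hpdf]
    exact (integrable_exp_neg_mul_sq (by norm_num)).const_mul _
  · rw [integral_gaussianReal_eq_integral_smul one_ne_zero]
    simp only [hpdf]
    rw [integral_const_mul, integral_gaussian, ← Real.sqrt_inv, ← Real.sqrt_mul (by positivity)]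
    apply Real.sqrt_le_iff.mpr
    refine ⟨by norm_num, ?_⟩
    field_simp
    norm_num

lemma integral_exp_mul_gaussianReal (t : ℝ) :
    ∫ g, Real.exp (t * g) ∂(gaussianReal 0 1) = Real.exp (t ^ 2 / 2) := by
  have := mgf_gaussianReal (p := gaussianReal 0 1) (X := id) (μ := 0) (v := 1) (by simp) t
  simpa [mgf] using this

/-- Exponential moment of the squared norm of a projection of a sub-Gaussian vector. -/
lemma lintegral_exp_sum_sq_inner_le {Ω ι E : Type*} [MeasurableSpace Ω] {μ : Measure Ω} [SFinite μ]
    [Fintype ι] [NormedAddCommGroup E] [InnerProductSpace ℝ E] [MeasurableSpace E] [BorelSpace E]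
    [SecondCountableTopology E]
    {e : Ω → E} (he : AEMeasurable e μ) {σ : ℝ} (hσ : 0 < σ)
    (hsub : ∀ u : E, ∫⁻ ω, ENNReal.ofReal (Real.exp ⟪u, e ω⟫) ∂μ
      ≤ ENNReal.ofReal (Real.exp (σ ^ 2 * ‖u‖ ^ 2 / 2)))
    {b : ι → E} (hb : Orthonormal ℝ b) :
    ∫⁻ ω, ENNReal.ofReal (Real.exp ((∑ k, ⟪b k, e ω⟫ ^ 2) / (4 * σ ^ 2))) ∂μ
      ≤ ENNReal.ofReal (2 ^ Fintype.card ι) := by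
  set γ : Measure (ι → ℝ) := Measure.pi fun _ => gaussianReal 0 1 with hγ
  -- Chosen so that `E exp(c a g) = exp(a² / (4σ²))` for standard normal `g`: the squares become an
  -- average of linear exponents, to which the sub-Gaussian bound applies after Tonelli.
  set c : ℝ := (√2 * σ)⁻¹ with hc
  have hc2 : c ^ 2 = (2 * σ ^ 2)⁻¹ := by
    rw [hc, inv_pow, mul_pow, Real.sq_sqrt (by norm_num)]
  have hexp : ∀ ω (g : ι → ℝ), ∏ k, Real.exp (c * ⟪b k, e ω⟫ * g k)
      = Real.exp ⟪∑ k, (c * g k) • b k, e ω⟫ := by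
    intro ω g
    rw [← Real.exp_sum, sum_inner]
    congr 1
    refine Finset.sum_congr rfl fun k _ => ?_
    rw [real_inner_smul_left]; ring
  have h1 : ∀ ω, ENNReal.ofReal (Real.exp ((∑ k, ⟪b k, e ω⟫ ^ 2) / (4 * σ ^ 2)))
      = ∫⁻ g, ENNReal.ofReal (Real.exp ⟪∑ k, (c * g k) • b k, e ω⟫) ∂γ := by
    intro ω
    rw [← ofReal_integral_eq_lintegral_ofReal]
    · congr 1
      simp_rw [← hexp ω]
      rw [hγ, integral_fintype_prod_eq_prod
        (f := fun k (x : ℝ) => Real.exp (c * ⟪b k, e ω⟫ * x))]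
      simp_rw [integral_exp_mul_gaussianReal]
      rw [← Real.exp_sum, Finset.sum_div]
      congr 1
      refine Finset.sum_congr rfl fun k _ => ?_
      rw [mul_pow, hc2]
      field_simp
      norm_num
    · simp_rw [← hexp ω]
      exact Integrable.fintype_prod (f := fun k (x : ℝ) => Real.exp (c * ⟪b k, e ω⟫ * x))
        fun k => integrable_exp_mul_gaussianReal _
    · exact ae_of_all _ fun g => (Real.exp_pos _).le
  simp_rw [h1]
  rw [lintegral_lintegral_swap]
  · calc ∫⁻ g, ∫⁻ ω, ENNReal.ofReal (Real.exp ⟪∑ k, (c * g k) • b k, e ω⟫) ∂μ ∂γ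
        ≤ ∫⁻ g, ENNReal.ofReal (∏ k, Real.exp (g k ^ 2 / 4)) ∂γ := by
          refine lintegral_mono fun g => (hsub _).trans (le_of_eq ?_)
          rw [← Real.exp_sum, ← real_inner_self_eq_norm_sq, hb.inner_sum]
          congr 2
          rw [Finset.mul_sum, Finset.sum_div]
          refine Finset.sum_congr rfl fun k _ => ?_
          have : c * g k * (c * g k) = (2 * σ ^ 2)⁻¹ * g k ^ 2 := by rw [← hc2]; ring
          simp only [conj_trivial, this]
          field_simp
          ring
      _ = ENNReal.ofReal (∫ g, ∏ k, Real.exp (g k ^ 2 / 4) ∂γ) := by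
          rw [ofReal_integral_eq_lintegral_ofReal]
          · exact Integrable.fintype_prod (f := fun _ (x : ℝ) => Real.exp (x ^ 2 / 4))
              fun k => integrable_exp_sq_gaussianReal.1
          · exact ae_of_all _ fun g => Finset.prod_nonneg fun _ _ => (Real.exp_pos _).le
      _ ≤ ENNReal.ofReal (2 ^ Fintype.card ι) := by
          apply ENNReal.ofReal_le_ofReal
          rw [hγ, integral_fintype_prod_eq_prod (f := fun _ (x : ℝ) => Real.exp (x ^ 2 / 4)),
            Finset.prod_const, Finset.card_univ]
          exact pow_le_pow_left₀ (integral_nonneg fun _ => (Real.exp_pos _).le)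
            integrable_exp_sq_gaussianReal.2 _
  · have h2 : AEMeasurable (fun q : Ω × (ι → ℝ) => e q.1) (μ.prod γ) := he.comp_fst
    have h3 : AEMeasurable (fun q : Ω × (ι → ℝ) => ∑ k, (c * q.2 k) • b k) (μ.prod γ) := by
      apply Measurable.aemeasurable
      fun_prop
    exact ((Real.measurable_exp.comp_aemeasurable (h3.inner h2))).ennreal_ofReal

/-- Tail bound for the squared norm of a projection of a sub-Gaussian vector. -/
lemma measure_le_norm_starProjection_sq {Ω E : Type*} [MeasurableSpace Ω] {μ : Measure Ω}
    [SFinite μ] [NormedAddCommGroup E] [InnerProductSpace ℝ E] [FiniteDimensional ℝ E]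
    [MeasurableSpace E] [BorelSpace E]
    {e : Ω → E} (he : AEMeasurable e μ) {σ : ℝ} (hσ : 0 < σ)
    (hsub : ∀ u : E, ∫⁻ ω, ENNReal.ofReal (Real.exp ⟪u, e ω⟫) ∂μ
      ≤ ENNReal.ofReal (Real.exp (σ ^ 2 * ‖u‖ ^ 2 / 2)))
    (W : Submodule ℝ E) {d : ℕ} (hd : Module.finrank ℝ W ≤ d) (t : ℝ) :
    μ {ω | 4 * σ ^ 2 * t ≤ ‖W.starProjection (e ω)‖ ^ 2}
      ≤ ENNReal.ofReal (2 ^ d * Real.exp (-t)) := by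
  have hsc : SecondCountableTopology E := by
    have := FiniteDimensional.proper ℝ E
    infer_instance
  let b := stdOrthonormalBasis ℝ W
  have hb : Orthonormal ℝ (fun k => (b k : E)) :=
    b.orthonormal.comp_linearIsometry W.subtypeₗᵢ
  have hn : ∀ v : E, ‖W.starProjection v‖ ^ 2 = ∑ k, ⟪(b k : E), v⟫ ^ 2 := by
    intro v
    rw [Submodule.starProjection_apply, Submodule.norm_coe, ← b.sum_sq_norm_inner_right]
    refine Finset.sum_congr rfl fun k _ => ?_
    rw [Real.norm_eq_abs, sq_abs, ← Submodule.inner_orthogonalProjectionOnto_eq_of_mem_left]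
  have key := lintegral_exp_sum_sq_inner_le he hσ hsub hb
  have hmeas : AEMeasurable (fun ω => ENNReal.ofReal
      (Real.exp ((∑ k, ⟪(b k : E), e ω⟫ ^ 2) / (4 * σ ^ 2)))) μ := by
    have : ∀ k, AEMeasurable (fun ω => ⟪(b k : E), e ω⟫) μ := fun k => aemeasurable_const.inner he
    fun_prop
  have mk := mul_meas_ge_le_lintegral₀ hmeas (ENNReal.ofReal (Real.exp t))
  have hsubset : {ω | 4 * σ ^ 2 * t ≤ ‖W.starProjection (e ω)‖ ^ 2} ⊆
      {ω | ENNReal.ofReal (Real.exp t) ≤ ENNReal.ofReal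
      (Real.exp ((∑ k, ⟪(b k : E), e ω⟫ ^ 2) / (4 * σ ^ 2)))} := by
    intro ω hω
    simp only [Set.mem_ofPred_eq] at hω ⊢
    apply ENNReal.ofReal_le_ofReal
    rw [Real.exp_le_exp, le_div_iff₀ (by positivity), ← hn]
    linarith
  have hpos : ENNReal.ofReal (Real.exp t) ≠ 0 := by simp [Real.exp_pos]
  calc μ _ ≤ μ _ := measure_mono hsubset
    _ ≤ ENNReal.ofReal (2 ^ d) / ENNReal.ofReal (Real.exp t) := by
        rw [ENNReal.le_div_iff_mul_le (Or.inl hpos) (Or.inl (by simp)), mul_comm]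
        refine mk.trans (key.trans (ENNReal.ofReal_le_ofReal ?_))
        exact pow_le_pow_right₀ (by norm_num) (by simpa using hd)
    _ = _ := by
        rw [← ENNReal.ofReal_div_of_pos (Real.exp_pos _), Real.exp_neg, div_eq_mul_inv]

/-! ### Concentration of the noise vector -/

section Noise

variable {Ω : Type*} [MeasurableSpace Ω] {μ : Measure Ω} {n : ℕ} {ε : Fin n → Ω → ℝ} {σ : ℝ≥0}

lemma aemeasurable_toLp (h : ∀ i, AEMeasurable (ε i) μ) :
    AEMeasurable (fun ω => (WithLp.toLp 2 fun i => ε i ω : EuclideanSpace ℝ (Fin n))) μ :=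
  (PiLp.continuous_toLp 2 _).measurable.comp_aemeasurable (aemeasurable_pi_lambda _ h)

lemma lintegral_exp_inner_le (h_indep : iIndepFun ε μ)
    (h_subG : ∀ i, HasSubgaussianMGF (ε i) (σ ^ 2) μ) (u : EuclideanSpace ℝ (Fin n)) :
    ∫⁻ ω, ENNReal.ofReal (Real.exp ⟪u, WithLp.toLp 2 fun i => ε i ω⟫) ∂μ
      ≤ ENNReal.ofReal (Real.exp ((σ : ℝ) ^ 2 * ‖u‖ ^ 2 / 2)) := by
  have hind : iIndepFun (fun i ω => u i * ε i ω) μ :=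
    h_indep.comp (fun i x => u i * x) fun i => by fun_prop
  have hs := HasSubgaussianMGF.sum_of_iIndepFun hind (s := Finset.univ)
    fun i _ => (h_subG i).const_mul (u i)
  have hi : ∀ ω, ⟪u, WithLp.toLp 2 fun i => ε i ω⟫ = 1 * ∑ i, u i * ε i ω := by
    intro ω
    simp [PiLp.inner_apply, mul_comm]
  simp_rw [hi]
  rw [← ofReal_integral_eq_lintegral_ofReal (hs.integrable_exp_mul 1)
    (ae_of_all _ fun _ => (Real.exp_pos _).le)]
  refine ENNReal.ofReal_le_ofReal ((hs.mgf_le 1).trans (le_of_eq ?_))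
  congr 1
  rw [EuclideanSpace.norm_sq_eq]
  simp only [NNReal.coe_sum, Real.norm_eq_abs, sq_abs, Finset.mul_sum, one_pow, mul_one]
  congr 1
  refine Finset.sum_congr rfl fun i _ => ?_
  change u i ^ 2 * (σ : ℝ) ^ 2 = _
  ring

/-- Tail bound for the projection of the noise vector on a subspace. -/
lemma measure_noise_projection_le [SFinite μ] (hσ : 0 < σ) (h_indep : iIndepFun ε μ)
    (h_subG : ∀ i, HasSubgaussianMGF (ε i) (σ ^ 2) μ)
    (W : Submodule ℝ (EuclideanSpace ℝ (Fin n))) {d : ℕ} (hd : Module.finrank ℝ W ≤ d) (t : ℝ) :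
    μ {ω | 4 * (σ : ℝ) ^ 2 * t ≤ ‖W.starProjection (WithLp.toLp 2 fun i => ε i ω)‖ ^ 2}
      ≤ ENNReal.ofReal (2 ^ d * Real.exp (-t)) :=
  measure_le_norm_starProjection_sq (aemeasurable_toLp fun i => (h_subG i).aemeasurable)
    (NNReal.coe_pos.mpr hσ) (lintegral_exp_inner_le h_indep h_subG) W hd t

/-- From `x⁴ / 4! ≤ exp |x| ≤ exp x + exp (-x)` and the moment generating function at `±1`. -/
lemma integral_pow_four_le {X : Ω → ℝ} (hX : HasSubgaussianMGF X (σ ^ 2) μ) :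
    Integrable (fun ω => X ω ^ 4) μ ∧
      ∫ ω, X ω ^ 4 ∂μ ≤ 48 * Real.exp ((σ : ℝ) ^ 2 / 2) := by
  have hpt : ∀ x : ℝ, x ^ 4 ≤ 24 * (Real.exp (1 * x) + Real.exp (-1 * x)) := by
    have aux : ∀ x : ℝ, 0 ≤ x → x ^ 4 ≤ 24 * Real.exp x := by
      intro x hx
      have := Real.pow_div_factorial_le_exp x hx 4
      norm_num [Nat.factorial] at this
      linarith
    intro x
    rw [one_mul, neg_one_mul]
    rcases le_total 0 x with hx | hx
    · have := aux x hx
      have := Real.exp_pos (-x)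
      linarith
    · have := aux (-x) (by linarith)
      have := Real.exp_pos x
      rw [Even.neg_pow (by decide)] at *
      linarith
  have hint : Integrable (fun ω => 24 * (Real.exp (1 * X ω) + Real.exp (-1 * X ω))) μ :=
    ((hX.integrable_exp_mul 1).add (hX.integrable_exp_mul (-1))).const_mul 24
  have hX4 : Integrable (fun ω => X ω ^ 4) μ := by
    refine hint.mono' (hX.aestronglyMeasurable.pow 4) (ae_of_all _ fun ω => ?_)
    rw [Real.norm_of_nonneg (by positivity)]
    exact hpt _
  refine ⟨hX4, (integral_mono hX4 hint fun ω => hpt _).trans ?_⟩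
  rw [integral_const_mul,
    integral_add (hX.integrable_exp_mul 1) (hX.integrable_exp_mul (-1))]
  have h1 := hX.mgf_le 1
  have h2 := hX.mgf_le (-1)
  simp only [mgf, NNReal.coe_pow] at h1 h2
  norm_num at h1 h2 ⊢
  linarith

/-- Weak law of large numbers for the squared norm of the noise. -/
lemma measure_noise_norm_sq_le [IsProbabilityMeasure μ] {v : ℝ} (hv : 0 < v) (hn : 0 < n)
    (h_indep : iIndepFun ε μ) (h_subG : ∀ i, HasSubgaussianMGF (ε i) (σ ^ 2) μ)
    (h_mean : ∀ i, ∫ ω, ε i ω ∂μ = 0) (h_var : ∀ i, v ≤ Var[ε i; μ]) :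
    μ {ω | ¬ (v / 2 * n ≤ ‖(WithLp.toLp 2 fun i => ε i ω : EuclideanSpace ℝ (Fin n))‖ ^ 2 ∧
        ‖(WithLp.toLp 2 fun i => ε i ω : EuclideanSpace ℝ (Fin n))‖ ^ 2
          ≤ (1 + 48 * Real.exp ((σ : ℝ) ^ 2 / 2) + v / 2) * n)}
      ≤ ENNReal.ofReal (48 * Real.exp ((σ : ℝ) ^ 2 / 2) / (v / 2) ^ 2 * (n : ℝ)⁻¹) := by
  set M := 48 * Real.exp ((σ : ℝ) ^ 2 / 2) with hM
  have h4 : ∀ i, MemLp (fun ω => ε i ω ^ 2) 2 μ := by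
    intro i
    refine (memLp_two_iff_integrable_sq ((h_subG i).aestronglyMeasurable.pow 2)).mpr ?_
    simpa [← pow_mul] using (integral_pow_four_le (h_subG i)).1
  have h2 : ∀ i, Integrable (fun ω => ε i ω ^ 2) μ := fun i =>
    (h4 i).integrable (by norm_num)
  set S : Ω → ℝ := fun ω => ∑ i, ε i ω ^ 2 with hS
  have hnorm : ∀ ω, ‖(WithLp.toLp 2 fun i => ε i ω : EuclideanSpace ℝ (Fin n))‖ ^ 2 = S ω := by
    intro ω
    simp [EuclideanSpace.norm_sq_eq, hS]
  have hSm : MemLp S 2 μ := memLp_finsetSum _ fun i _ => h4 i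
  have hvar : Var[S; μ] ≤ n * M := by
    have : S = ∑ i, fun ω => ε i ω ^ 2 := by ext ω; simp [hS]
    rw [this, IndepFun.variance_sum (fun i _ => h4 i)]
    · calc ∑ i, Var[fun ω => ε i ω ^ 2; μ] ≤ ∑ _i : Fin n, M := by
            refine Finset.sum_le_sum fun i _ => ?_
            refine (variance_le_expectation_sq (h4 i).aestronglyMeasurable).trans ?_
            have := (integral_pow_four_le (h_subG i)).2
            simpa [← pow_mul] using this
        _ = n * M := by simp
    · intro i _ j _ hij
      exact (h_indep.indepFun hij).comp (measurable_id.pow_const 2) (measurable_id.pow_const 2)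
  have hmean : ∫ ω, S ω ∂μ = ∑ i, ∫ ω, ε i ω ^ 2 ∂μ := integral_finsetSum _ fun i _ => h2 i
  have hm : ∀ i, v ≤ ∫ ω, ε i ω ^ 2 ∂μ ∧ ∫ ω, ε i ω ^ 2 ∂μ ≤ 1 + M := by
    intro i
    constructor
    · refine (h_var i).trans (le_of_eq ?_)
      rw [variance_of_integral_eq_zero (h_subG i).aemeasurable (h_mean i)]
    · have h4i := integral_pow_four_le (h_subG i)
      calc ∫ ω, ε i ω ^ 2 ∂μ ≤ ∫ ω, (1 + ε i ω ^ 4) ∂μ := by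
            refine integral_mono (h2 i) ((integrable_const _).add h4i.1) fun ω => ?_
            show ε i ω ^ 2 ≤ 1 + ε i ω ^ 4
            nlinarith [sq_nonneg (ε i ω ^ 2 - 1), sq_nonneg (ε i ω ^ 2)]
        _ ≤ 1 + M := by
            rw [integral_add (integrable_const _) h4i.1]
            simpa using h4i.2
  have hlow : n * v ≤ ∫ ω, S ω ∂μ := by
    rw [hmean]
    calc (n : ℝ) * v = ∑ _i : Fin n, v := by simp
      _ ≤ _ := Finset.sum_le_sum fun i _ => (hm i).1
  have hup : ∫ ω, S ω ∂μ ≤ n * (1 + M) := by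
    rw [hmean]
    calc _ ≤ ∑ _i : Fin n, (1 + M) := Finset.sum_le_sum fun i _ => (hm i).2
      _ = (n : ℝ) * (1 + M) := by simp [mul_add]
  have hn' : (0 : ℝ) < n := Nat.cast_pos.mpr hn
  have hc : 0 < v / 2 * n := by positivity
  -- Chebyshev with deviation `v n / 2`: the mean of `‖ε‖²` lies between `v n` and `(1 + M) n`.
  refine (measure_mono ?_).trans ((meas_ge_le_variance_div_sq hSm hc).trans ?_)
  · intro ω hω
    simp only [Set.mem_ofPred_eq, hnorm, not_and_or, not_le] at hω ⊢
    rw [le_abs]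
    rcases hω with h | h
    · right; linarith
    · left; linarith
  · apply ENNReal.ofReal_le_ofReal
    calc Var[S; μ] / (v / 2 * n) ^ 2 ≤ n * M / (v / 2 * n) ^ 2 := by gcongr
      _ = _ := by field_simp

end Noise

lemma sum_mul_le_of_abs_le {ι : Type*} {s : Finset ι} {δ z : ι → ℝ} {c : ℝ} (hz : ∀ j, |z j| ≤ c) :
    ∑ j ∈ s, δ j * z j ≤ c * ∑ j ∈ s, |δ j| := by
  rw [Finset.mul_sum]
  refine Finset.sum_le_sum fun j _ => (le_abs_self _).trans ?_
  rw [abs_mul, mul_comm]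
  exact mul_le_mul_of_nonneg_right (hz j) (abs_nonneg _)

/-! ### Lasso, oracle least squares and the two CCCP steps -/

section Deterministic

variable {ι E : Type*} [Fintype ι] [NormedAddCommGroup E] [InnerProductSpace ℝ E]

/-- The linear combination of the vectors `x j` with coefficients `b j`. -/
def fit (x : ι → E) (b : ι → ℝ) : E := ∑ j, b j • x j

lemma fit_sub (x : ι → E) (b c : ι → ℝ) : fit x (b - c) = fit x b - fit x c := by
  simp [fit, sub_smul, Finset.sum_sub_distrib]

lemma inner_fit (x : ι → E) (b : ι → ℝ) (r : E) : ⟪r, fit x b⟫ = ∑ j, b j * ⟪x j, r⟫ := by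
  simp only [fit, inner_sum, real_inner_smul_right]
  exact Finset.sum_congr rfl fun j _ => by rw [real_inner_comm]

/-- The loss is quadratic, so its second-order expansion is exact; this replaces subgradient
arguments. -/
lemma norm_sub_fit_sq (x : ι → E) (y : E) (b c : ι → ℝ) :
    ‖y - fit x b‖ ^ 2 = ‖y - fit x c‖ ^ 2
      - 2 * ∑ j, (b j - c j) * ⟪x j, y - fit x c⟫ + ‖fit x (b - c)‖ ^ 2 := by
  have h : y - fit x b = (y - fit x c) - fit x (b - c) := by rw [fit_sub]; abel
  rw [h, norm_sub_sq_real, inner_fit]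
  rfl

lemma exists_fit_eq_of_mem_span (x : ι → E) (A : Finset ι) {z : E}
    (hz : z ∈ Submodule.span ℝ (Set.range fun j : A => x j)) :
    ∃ b : ι → ℝ, (∀ j ∉ A, b j = 0) ∧ fit x b = z := by
  classical
  obtain ⟨c, hc⟩ := (Submodule.mem_span_range_iff_exists_fun ℝ).mp hz
  refine ⟨fun j => if h : j ∈ A then c ⟨j, h⟩ else 0, fun j hj => by simp [hj], ?_⟩
  rw [← hc, fit, ← Finset.sum_subset (Finset.subset_univ A), ← Finset.sum_coe_sort]
  · exact Finset.sum_congr rfl fun j _ => by simp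
  · intro j _ hj
    simp [hj]

lemma fit_mem_span (x : ι → E) {A : Finset ι} {b : ι → ℝ} (hb : ∀ j ∉ A, b j = 0) :
    fit x b ∈ Submodule.span ℝ (Set.range fun j : A => x j) := by
  refine Submodule.sum_mem _ fun j _ => ?_
  by_cases hj : j ∈ A
  · exact Submodule.smul_mem _ _ (Submodule.subset_span ⟨⟨j, hj⟩, rfl⟩)
  · simp [hb j hj]

variable [DecidableEq ι] {x : ι → E} {A : Finset ι} {g n : ℝ}

/-- The restricted eigenvalue condition with squared constant `g`. -/
def RestrictedEigen (x : ι → E) (A : Finset ι) (g n : ℝ) : Prop :=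
  ∀ δ : ι → ℝ, ∑ j ∈ Aᶜ, |δ j| ≤ 3 * ∑ j ∈ A, |δ j| →
    g * n * ∑ j ∈ A, δ j ^ 2 ≤ ‖fit x δ‖ ^ 2

/-- Cauchy–Schwarz on `A` turns the `ℓ₂` condition into control of the `ℓ₁` error. -/
lemma RestrictedEigen.l1_sq_le (h : RestrictedEigen x A g n) (hg : 0 ≤ g) (hn : 0 ≤ n)
    {δ : ι → ℝ} (hδ : ∑ j ∈ Aᶜ, |δ j| ≤ 3 * ∑ j ∈ A, |δ j|) :
    g * n * (∑ j ∈ A, |δ j|) ^ 2 ≤ A.card * ‖fit x δ‖ ^ 2 := by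
  have h1 : (∑ j ∈ A, |δ j|) ^ 2 ≤ A.card * ∑ j ∈ A, δ j ^ 2 := by
    simpa using sq_sum_le_card_mul_sum_sq (s := A) (f := fun j => |δ j|)
  calc g * n * (∑ j ∈ A, |δ j|) ^ 2 ≤ g * n * (A.card * ∑ j ∈ A, δ j ^ 2) := by gcongr
    _ = A.card * (g * n * ∑ j ∈ A, δ j ^ 2) := by ring
    _ ≤ _ := by gcongr; exact h δ hδ

/-- Sup-norm estimation error of the Lasso under the restricted eigenvalue condition. -/
lemma lasso_abs_sub_le (hRE : RestrictedEigen x A g n) (hg : 0 < g) (hn : 0 < n)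
    {l : ℝ} (hl : 0 < l) {β b : ι → ℝ} (hβ : ∀ j ∉ A, β j = 0) {e : E}
    (he : ∀ j, |⟪x j, e⟫| ≤ n * l / 2)
    (hmin : 1 / (2 * n) * ‖fit x β + e - fit x b‖ ^ 2 + l * ∑ j, |b j|
      ≤ 1 / (2 * n) * ‖fit x β + e - fit x β‖ ^ 2 + l * ∑ j, |β j|) (j : ι) :
    |b j - β j| ≤ 9 * l * A.card / g := by
  set δ : ι → ℝ := b - β with hδ
  set S := ∑ j ∈ A, |δ j| with hS
  set T := ∑ j ∈ Aᶜ, |δ j| with hT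
  set D := ‖fit x δ‖ ^ 2 with hD
  have hsplit : ∑ j, |δ j| = S + T := (Finset.sum_add_sum_compl A _).symm
  have hS0 : 0 ≤ S := Finset.sum_nonneg fun _ _ => abs_nonneg _
  have hT0 : 0 ≤ T := Finset.sum_nonneg fun _ _ => abs_nonneg _
  have hpen : ∑ j, |β j| - ∑ j, |b j| ≤ S - T := by
    rw [← Finset.sum_sub_distrib, ← Finset.sum_add_sum_compl A, sub_eq_add_neg S T, hT,
      ← Finset.sum_neg_distrib]
    refine add_le_add (Finset.sum_le_sum fun k _ => ?_) (Finset.sum_le_sum fun k hk => ?_)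
    · rw [hδ, Pi.sub_apply, abs_sub_comm]
      exact abs_sub_abs_le_abs_sub _ _
    · simp [hδ, hβ k (Finset.mem_compl.mp hk)]
  have hcross : ∑ j, (b j - β j) * ⟪x j, e⟫ ≤ n * l / 2 * (S + T) := by
    rw [← hsplit]
    exact sum_mul_le_of_abs_le (δ := δ) he
  have hexp := norm_sub_fit_sq x (fit x β + e) b β
  rw [add_sub_cancel_left] at hexp hmin
  -- Noise at half the penalty level leaves the factors `1 + 1/2` on `A` and `1 - 1/2` off it, whose
  -- ratio is the cone constant `3`.
  have hbasic : D + n * l * T ≤ 3 * n * l * S := by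
    have h1 : 1 / (2 * n) * D ≤ 1 / (2 * n) * (n * l * (S + T)) + l * (S - T) := by
      rw [hexp] at hmin
      have : 1 / (2 * n) * (2 * ∑ j, (b j - β j) * ⟪x j, e⟫)
          ≤ 1 / (2 * n) * (n * l * (S + T)) := by
        refine mul_le_mul_of_nonneg_left ?_ (by positivity)
        linarith
      have h3 := mul_le_mul_of_nonneg_left hpen hl.le
      change 1 / (2 * n) * (‖e‖ ^ 2 - 2 * ∑ j, (b j - β j) * ⟪x j, e⟫ + D) + _ ≤ _ at hmin
      linarith
    have h2 := mul_le_mul_of_nonneg_left h1 (by positivity : (0 : ℝ) ≤ 2 * n)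
    field_simp at h2
    linarith
  have hD0 : 0 ≤ D := sq_nonneg _
  have hnl : 0 < n * l := by positivity
  have hcone : T ≤ 3 * S := by
    by_contra hcon
    push Not at hcon
    nlinarith [mul_lt_mul_of_pos_left hcon hnl]
  have hl1 := hRE.l1_sq_le hg.le hn.le hcone
  have hDS : D ≤ 3 * n * l * S := by nlinarith [mul_nonneg hnl.le hT0]
  have hSle : g * S ≤ 3 * l * A.card := by
    rcases hS0.eq_or_lt with h0 | h0
    · rw [← h0, mul_zero]; positivity
    · have h1 : n * S * (g * S) ≤ n * S * (3 * l * A.card) := by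
        calc n * S * (g * S) = g * n * S ^ 2 := by ring
          _ ≤ A.card * D := hl1
          _ ≤ A.card * (3 * n * l * S) := by gcongr
          _ = _ := by ring
      exact le_of_mul_le_mul_left h1 (by positivity)
  rw [le_div_iff₀ hg]
  -- Off `A` a coordinate is bounded by `T ≤ 3 * S`; with `S ≤ 3 l |A| / g` this gives the `9`.
  have hj : |δ j| ≤ 3 * S := by
    by_cases hjA : j ∈ A
    · have : |δ j| ≤ S := Finset.single_le_sum (f := fun k => |δ k|) (fun _ _ => abs_nonneg _) hjA
      linarith
    · exact (Finset.single_le_sum (f := fun k => |δ k|) (fun _ _ => abs_nonneg _)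
        (Finset.mem_compl.mpr hjA)).trans hcone
  calc |δ j| * g ≤ 3 * S * g := by gcongr
    _ ≤ _ := by linarith

/-- Error bounds for the least squares estimator on the true support. -/
lemma oracle_error_le (hRE : RestrictedEigen x A g n) (hg : 0 < g) (hn : 0 < n)
    {l : ℝ} (hl : 0 < l) {β b : ι → ℝ} (hβ : ∀ j ∉ A, β j = 0) (hb : ∀ j ∉ A, b j = 0) {e : E}
    (he : ∀ j, |⟪x j, e⟫| ≤ n * l / 2)
    (horth : ∀ j ∈ A, ⟪x j, fit x β + e - fit x b⟫ = 0) :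
    (∀ j, |b j - β j| ≤ l * A.card / (2 * g)) ∧
      ‖fit x (b - β)‖ ^ 2 ≤ n * l ^ 2 * A.card / (4 * g) := by
  set δ : ι → ℝ := b - β with hδ
  set S := ∑ j ∈ A, |δ j| with hS
  have hδ0 : ∀ j ∉ A, δ j = 0 := fun j hj => by simp [hδ, hβ j hj, hb j hj]
  have hS0 : 0 ≤ S := Finset.sum_nonneg fun _ _ => abs_nonneg _
  have hcone : ∑ j ∈ Aᶜ, |δ j| ≤ 3 * S := by
    rw [Finset.sum_eq_zero fun j hj => by simp [hδ0 j (Finset.mem_compl.mp hj)]]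
    positivity
  -- The normal equations on `A` replace `⟪x j, fit x δ⟫` by `⟪x j, e⟫`.
  have hDeq : ‖fit x δ‖ ^ 2 = ∑ j ∈ A, δ j * ⟪x j, e⟫ := by
    rw [← real_inner_self_eq_norm_sq, inner_fit, ← Finset.sum_add_sum_compl A,
      Finset.sum_eq_zero (s := Aᶜ) fun j hj => by simp [hδ0 j (Finset.mem_compl.mp hj)], add_zero]
    refine Finset.sum_congr rfl fun j hj => ?_
    have h1 := horth j hj
    have h2 : fit x β + e - fit x b = e - fit x δ := by rw [hδ, fit_sub]; abel
    rw [h2, inner_sub_right, sub_eq_zero] at h1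
    rw [h1]
  have hD : ‖fit x δ‖ ^ 2 ≤ n * l / 2 * S := by
    rw [hDeq]
    exact sum_mul_le_of_abs_le he
  have hl1 := hRE.l1_sq_le hg.le hn.le hcone
  have hSle : S ≤ l * A.card / (2 * g) := by
    rw [le_div_iff₀ (by positivity)]
    rcases hS0.eq_or_lt with h0 | h0
    · rw [← h0, zero_mul]; positivity
    · have h1 : n * S * (S * (2 * g)) ≤ n * S * (l * A.card) := by
        calc n * S * (S * (2 * g)) = 2 * (g * n * S ^ 2) := by ring
          _ ≤ 2 * (A.card * ‖fit x δ‖ ^ 2) := by gcongr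
          _ ≤ 2 * (A.card * (n * l / 2 * S)) := by gcongr
          _ = _ := by ring
      exact le_of_mul_le_mul_left h1 (by positivity)
  constructor
  · intro j
    by_cases hj : j ∈ A
    · exact (Finset.single_le_sum (f := fun k => |δ k|) (fun _ _ => abs_nonneg _) hj).trans hSle
    · have : b j - β j = 0 := hδ0 j hj
      rw [this, abs_zero]
      positivity
  · calc ‖fit x δ‖ ^ 2 ≤ n * l / 2 * S := hD
      _ ≤ n * l / 2 * (l * A.card / (2 * g)) := by gcongr
      _ = _ := by field_simp; ring

/-- A vector satisfying strict optimality conditions is the only minimizer of the weighted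
penalized least squares criterion. -/
lemma eq_of_strict_optimality (hRE : RestrictedEigen x A g n) (hg : 0 < g) (hn : 0 < n)
    {l : ℝ} (hl : 0 < l) {y : E} {w b c : ι → ℝ} (hc : ∀ j ∉ A, c j = 0)
    (horth : ∀ j ∈ A, ⟪x j, y - fit x c⟫ = 0)
    (hw : ∀ j ∈ A, |w j| ≤ l) (hwc : ∀ j ∈ A, w j * c j + l * |c j| = 0)
    (hw' : ∀ j ∉ A, |w j| ≤ l / 4) (hr : ∀ j ∉ A, |⟪x j, y - fit x c⟫| ≤ n * l / 2)
    (hmin : 1 / (2 * n) * ‖y - fit x b‖ ^ 2 + ∑ j, w j * b j + l * ∑ j, |b j|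
      ≤ 1 / (2 * n) * ‖y - fit x c‖ ^ 2 + ∑ j, w j * c j + l * ∑ j, |c j|) :
    b = c := by
  set r := y - fit x c with hr_def
  -- Off `A`, the slack `l / 4` is what the penalty `l` retains after the weight `l / 4` and the
  -- residual correlation `l / 2`. It forces `b` to vanish there; the restricted eigenvalue then
  -- identifies `b` with `c` on `A`.
  have hpt : ∀ j, (if j ∈ A then 0 else l / 4 * |b j|) ≤
      w j * b j + l * |b j| - (w j * c j + l * |c j|) - 1 / n * ((b j - c j) * ⟪x j, r⟫) := by
    intro j
    have hwb : -(|w j| * |b j|) ≤ w j * b j := by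
      rw [← abs_mul]; exact neg_abs_le _
    by_cases hj : j ∈ A
    · rw [if_pos hj, hwc j hj, horth j hj]
      nlinarith [hw j hj, abs_nonneg (b j)]
    · rw [if_neg hj, hc j hj]
      have h1 : 1 / n * ((b j - 0) * ⟪x j, r⟫) ≤ l / 2 * |b j| := by
        calc 1 / n * ((b j - 0) * ⟪x j, r⟫) ≤ 1 / n * (|b j| * (n * l / 2)) := by
              refine mul_le_mul_of_nonneg_left ?_ (by positivity)
              rw [sub_zero]
              refine (le_abs_self _).trans ?_
              rw [abs_mul]
              gcongr
              exact hr j hj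
          _ = _ := by field_simp
      have h2 : |w j| * |b j| ≤ l / 4 * |b j| := by gcongr; exact hw' j hj
      simp only [mul_zero, abs_zero, add_zero, sub_zero] at h1 ⊢
      linarith
  have hsum := Finset.sum_le_sum fun j (_ : j ∈ Finset.univ) => hpt j
  have hexp := norm_sub_fit_sq x y b c
  rw [hexp] at hmin
  simp only [Finset.sum_sub_distrib, Finset.sum_add_distrib, ← Finset.mul_sum] at hsum
  have hcn : 1 / (2 * n) * (2 * ∑ j, (b j - c j) * ⟪x j, r⟫)
      = 1 / n * ∑ j, (b j - c j) * ⟪x j, r⟫ := by field_simp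
  have htot : 1 / (2 * n) * ‖fit x (b - c)‖ ^ 2 + ∑ j, (if j ∈ A then 0 else l / 4 * |b j|) ≤ 0 := by
    linarith
  have hnn : ∀ j ∈ Finset.univ, 0 ≤ (if j ∈ A then 0 else l / 4 * |b j|) := by
    intro j _
    split_ifs <;> positivity
  have hz : ∑ j, (if j ∈ A then 0 else l / 4 * |b j|) = 0 :=
    le_antisymm (by linarith [(by positivity : 0 ≤ 1 / (2 * n) * ‖fit x (b - c)‖ ^ 2)])
      (Finset.sum_nonneg hnn)
  have hb : ∀ j ∉ A, b j = 0 := by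
    intro j hj
    have := (Finset.sum_eq_zero_iff_of_nonneg hnn).mp hz j (Finset.mem_univ j)
    rw [if_neg hj] at this
    simpa [hl.ne'] using this
  have hfit : ‖fit x (b - c)‖ ^ 2 ≤ 0 := by
    rw [hz, add_zero] at htot
    exact nonpos_of_mul_nonpos_right htot (by positivity)
  have hcone : ∑ j ∈ Aᶜ, |(b - c) j| ≤ 3 * ∑ j ∈ A, |(b - c) j| := by
    rw [Finset.sum_eq_zero fun j hj => by
      simp [hb j (Finset.mem_compl.mp hj), hc j (Finset.mem_compl.mp hj)]]
    exact mul_nonneg (by norm_num) (Finset.sum_nonneg fun _ _ => abs_nonneg _)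
  have hA := (hRE _ hcone).trans hfit
  have hA0 : ∑ j ∈ A, (b - c) j ^ 2 = 0 :=
    le_antisymm (nonpos_of_mul_nonpos_right hA (by positivity))
      (Finset.sum_nonneg fun _ _ => sq_nonneg _)
  ext j
  by_cases hj : j ∈ A
  · have := (Finset.sum_eq_zero_iff_of_nonneg fun _ _ => sq_nonneg _).mp hA0 j hj
    exact sub_eq_zero.mp (by simpa using this)
  · rw [hb j hj, hc j hj]

lemma sign_eq_of_abs_sub_lt {u t : ℝ} (h : |u - t| < |t|) : Real.sign u = Real.sign t := by
  rcases lt_trichotomy t 0 with ht | ht | ht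
  · rw [abs_of_neg ht, abs_lt] at h
    rw [Real.sign_of_neg ht, Real.sign_of_neg (by linarith)]
  · rw [ht, abs_zero] at h
    exact absurd h (not_lt.mpr (abs_nonneg _))
  · rw [abs_of_pos ht, abs_lt] at h
    rw [Real.sign_of_pos ht, Real.sign_of_pos (by linarith)]

/-- The second CCCP iterate is the least squares estimator on the true support, and it recovers
this support. -/
theorem cccp_oracle [FiniteDimensional ℝ E] (hRE : RestrictedEigen x A g n) (hg : 0 < g)
    (hn : 0 < n) (hx : ∀ j, ‖x j‖ ^ 2 = n) {l τ a b : ℝ} (hl : 0 < l) (hτ : 0 < τ)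
    (hτ1 : τ ≤ 1 / 2) (ha : 0 < a)
    (hηb : 9 * τ * A.card / g ≤ b) (hη : 9 * τ * A.card / g ≤ 1 / 4)
    {β : ι → ℝ} (hβ : ∀ j ∉ A, β j = 0) (hβd : ∀ j ∈ A, (a + 1) * l < |β j|)
    {h : ℝ → ℝ} (hlarge : ∀ t, a * l < |t| → h t = -l * Real.sign t)
    (hsmall : ∀ t, |t| ≤ b * l → |h t| ≤ |t|)
    {e : E} (he : ∀ j, |⟪x j, e⟫| ≤ n * (τ * l) / 2) {b₁ b₂ : ι → ℝ}
    (h₁ : ∀ c : ι → ℝ, 1 / (2 * n) * ‖fit x β + e - fit x b₁‖ ^ 2 + (τ * l) * ∑ j, |b₁ j|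
      ≤ 1 / (2 * n) * ‖fit x β + e - fit x c‖ ^ 2 + (τ * l) * ∑ j, |c j|)
    (h₂ : ∀ c : ι → ℝ,
      1 / (2 * n) * ‖fit x β + e - fit x b₂‖ ^ 2 + ∑ j, h (b₁ j) * b₂ j + l * ∑ j, |b₂ j|
      ≤ 1 / (2 * n) * ‖fit x β + e - fit x c‖ ^ 2 + ∑ j, h (b₁ j) * c j + l * ∑ j, |c j|) :
    (∀ j, b₂ j ≠ 0 ↔ j ∈ A) ∧ ∀ j ∈ A, ⟪x j, fit x β + e - fit x b₂⟫ = 0 := by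
  set y := fit x β + e with hy
  set V := Submodule.span ℝ (Set.range fun j : A => x j) with hV
  -- The oracle `c`: coefficients, supported on `A`, of the projection of `y` on the true model.
  obtain ⟨c, hc, hcy⟩ := exists_fit_eq_of_mem_span x A (V.starProjection_apply_mem y)
  have horth : ∀ j ∈ A, ⟪x j, y - fit x c⟫ = 0 := by
    intro j hj
    rw [real_inner_comm, hcy]
    exact V.starProjection_inner_eq_zero _ _ (Submodule.subset_span ⟨⟨j, hj⟩, rfl⟩)
  have hτl : 0 < τ * l := by positivity
  have hlasso : ∀ j, |b₁ j - β j| ≤ 9 * τ * A.card / g * l := fun j =>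
    (lasso_abs_sub_le hRE hg hn hτl hβ he (h₁ β) j).trans (le_of_eq (by ring))
  obtain ⟨horac, hpred⟩ := oracle_error_le hRE hg hn hτl hβ hc he horth
  have hηl : 9 * τ * A.card / g * l ≤ 1 / 4 * l := by gcongr
  have hηbl : 9 * τ * A.card / g * l ≤ b * l := by gcongr
  have horac' : ∀ j, |c j - β j| ≤ l := by
    intro j
    have h1 : τ * l * A.card / (2 * g) = 1 / 18 * (9 * τ * A.card / g * l) := by
      field_simp; ring
    have := horac j
    rw [h1] at this
    linarith
  have hal : 0 < a * l := by positivity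
  have hsign1 : ∀ j ∈ A, Real.sign (b₁ j) = Real.sign (β j) := fun j hj =>
    sign_eq_of_abs_sub_lt (by nlinarith [hlasso j, hβd j hj])
  have hsignc : ∀ j ∈ A, Real.sign (c j) = Real.sign (β j) := fun j hj =>
    sign_eq_of_abs_sub_lt (by nlinarith [horac' j, hβd j hj])
  have hβ0 : ∀ j ∈ A, β j ≠ 0 := fun j hj h0 => by
    have := hβd j hj
    rw [h0, abs_zero] at this
    nlinarith
  -- A signal above `(a + 1) * l` with Lasso error at most `l / 4` puts `b₁ j` in the flat region
  -- `|t| > a * l` of the penalty, with the sign of `β j`, hence of `c j`.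
  have hw : ∀ j ∈ A, h (b₁ j) = -l * Real.sign (c j) := by
    intro j hj
    rw [hlarge, hsign1 j hj, hsignc j hj]
    have h1 := abs_sub_abs_le_abs_sub (β j) (b₁ j)
    rw [abs_sub_comm] at h1
    nlinarith [hlasso j, hβd j hj]
  have hw' : ∀ j ∉ A, |h (b₁ j)| ≤ l / 4 := by
    intro j hj
    have h1 := hlasso j
    rw [hβ j hj, sub_zero] at h1
    exact (hsmall _ (h1.trans hηbl)).trans (by linarith)
  have hr : ∀ j ∉ A, |⟪x j, y - fit x c⟫| ≤ n * l / 2 := by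
    intro j _
    have h2 : y - fit x c = e - fit x (c - β) := by rw [hy, fit_sub]; abel
    -- Half of the allowance `n * l / 2` goes to the oracle's prediction error, the other half to
    -- the noise, where `τ ≤ 1 / 2` is needed.
    have h3 : |⟪x j, fit x (c - β)⟫| ≤ n * l / 4 := by
      refine abs_le_of_sq_le_sq ?_ (by positivity)
      calc ⟪x j, fit x (c - β)⟫ ^ 2 ≤ (‖x j‖ * ‖fit x (c - β)‖) ^ 2 := by
            rw [← sq_abs]
            gcongr
            exact abs_real_inner_le_norm _ _
        _ = n * ‖fit x (c - β)‖ ^ 2 := by rw [mul_pow, hx]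
        _ ≤ n * (n * (τ * l) ^ 2 * A.card / (4 * g)) := by gcongr
        _ = (n * l) ^ 2 / 36 * τ * (9 * τ * A.card / g) := by field_simp; ring
        _ ≤ (n * l) ^ 2 / 36 * (1 / 2) * (1 / 4) := by gcongr
        _ ≤ (n * l / 4) ^ 2 := by nlinarith [sq_nonneg (n * l)]
    rw [h2, inner_sub_right]
    refine (abs_sub _ _).trans ?_
    have h4 : n * (τ * l) / 2 ≤ n * (1 / 2 * l) / 2 := by gcongr
    linarith [he j]
  have hsa : ∀ u : ℝ, Real.sign u * u = |u| := fun u => by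
    rcases lt_trichotomy u 0 with hu | hu | hu
    · rw [Real.sign_of_neg hu, abs_of_neg hu]; ring
    · simp [hu]
    · rw [Real.sign_of_pos hu, abs_of_pos hu]; ring
  have hbc : b₂ = c := by
    refine eq_of_strict_optimality hRE hg hn hl hc horth ?_ ?_ hw' hr (h₂ c)
    · intro j hj
      rw [hw j hj, abs_mul, abs_neg, abs_of_pos hl]
      have : |Real.sign (c j)| ≤ 1 := by
        rcases Real.sign_apply_eq (c j) with h | h | h <;> simp [h]
      nlinarith
    · intro j hj
      rw [hw j hj, mul_assoc, hsa]; ring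
  rw [hbc]
  refine ⟨fun j => ⟨fun hj => by_contra fun hA => hj (hc j hA), fun hj h0 => ?_⟩, horth⟩
  have h1 := hsignc j hj
  rw [h0, Real.sign_zero, eq_comm, Real.sign_eq_zero_iff] at h1
  exact hβ0 j hj h1

end Deterministic

/-! ### Residual sums of squares of over- and underfitted models -/

section ModelComparison

variable {ι E : Type*} [NormedAddCommGroup E] [InnerProductSpace ℝ E]

/-- The span of the vectors `x j` with index in `A`. -/
def modelSpan (x : ι → E) (A : Finset ι) : Submodule ℝ E :=
  Submodule.span ℝ (Set.range fun j : A => x j)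

lemma mem_modelSpan (x : ι → E) {A : Finset ι} {j : ι} (hj : j ∈ A) : x j ∈ modelSpan x A :=
  Submodule.subset_span ⟨⟨j, hj⟩, rfl⟩

lemma modelSpan_mono (x : ι → E) {A B : Finset ι} (h : A ⊆ B) : modelSpan x A ≤ modelSpan x B := by
  refine Submodule.span_le.mpr ?_
  rintro _ ⟨j, rfl⟩
  exact mem_modelSpan x (h j.2)

lemma finrank_modelSpan_le (x : ι → E) (A : Finset ι) :
    Module.finrank ℝ (modelSpan x A) ≤ A.card := by
  have := finrank_range_le_card (R := ℝ) (b := fun j : A => x j)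
  rwa [Fintype.card_coe] at this

variable [FiniteDimensional ℝ E]

/-- The part of the span of a larger model orthogonal to a smaller one. -/
noncomputable def extraSpan (x : ι → E) (A B : Finset ι) : Submodule ℝ E :=
  (modelSpan x A)ᗮ ⊓ modelSpan x B

/-- The dimension is that of the larger span minus that of the smaller, and each added column raises
the span's dimension by at most one. -/
lemma finrank_extraSpan_le [DecidableEq ι] (x : ι → E) {A B : Finset ι} (h : A ⊆ B) :
    Module.finrank ℝ (extraSpan x A B) ≤ (B \ A).card := by
  have h1 := Submodule.finrank_add_inf_finrank_orthogonal (𝕜 := ℝ) (modelSpan_mono x h)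
  have h2 : modelSpan x B ≤ modelSpan x A ⊔ modelSpan x (B \ A) := by
    refine Submodule.span_le.mpr ?_
    rintro _ ⟨j, rfl⟩
    by_cases hj : (j : ι) ∈ A
    · exact Submodule.mem_sup_left (mem_modelSpan x hj)
    · exact Submodule.mem_sup_right (mem_modelSpan x (Finset.mem_sdiff.mpr ⟨j.2, hj⟩))
  have h3 := Submodule.finrank_mono h2
  have h4 := Submodule.finrank_add_le_finrank_add_finrank (modelSpan x A) (modelSpan x (B \ A))
  have h5 := finrank_modelSpan_le x (B \ A)
  rw [extraSpan]
  omega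

lemma norm_sub_starProjection_sq (W : Submodule ℝ E) (r : E) :
    ‖r - W.starProjection r‖ ^ 2 = ‖r‖ ^ 2 - ‖W.starProjection r‖ ^ 2 := by
  have := Submodule.norm_sq_eq_add_norm_sq_starProjection r W
  rw [Submodule.starProjection_orthogonal_val] at this
  linarith

lemma norm_sub_starProjection_le (W : Submodule ℝ E) (r : E) {w : E} (hw : w ∈ W) :
    ‖r - W.starProjection r‖ ≤ ‖r - w‖ := by
  rw [Submodule.starProjection_minimal]
  exact ciInf_le ⟨0, by rintro _ ⟨_, rfl⟩; exact norm_nonneg _⟩ (⟨w, hw⟩ : W)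

lemma sub_starProjection_eq_of_mem (W : Submodule ℝ E) {m : E} (hm : m ∈ W) (e : E) :
    m + e - W.starProjection (m + e) = e - W.starProjection e := by
  rw [map_add, Submodule.starProjection_eq_self_iff.mpr hm]
  abel

/-- Residual sum of squares of an overfitted model. -/
lemma overfit_norm_sq_ge (x : ι → E) {A B : Finset ι} {m e z : E} (hm : m ∈ modelSpan x A)
    (h : A ⊆ B) (hz : z ∈ modelSpan x B) :
    ‖m + e - (modelSpan x A).starProjection (m + e)‖ ^ 2 - ‖(extraSpan x A B).starProjection e‖ ^ 2
      ≤ ‖m + e - z‖ ^ 2 := by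
  set V := modelSpan x A with hV
  set U := extraSpan x A B with hU
  set u := z - V.starProjection z with hu
  have huU : u ∈ U := by
    refine ⟨V.sub_starProjection_mem_orthogonal z, Submodule.sub_mem _ hz ?_⟩
    exact modelSpan_mono x h (V.starProjection_apply_mem z)
  set r := m + e - V.starProjection (m + e) with hr
  have hre : r = e - V.starProjection e := sub_starProjection_eq_of_mem V hm e
  -- `U` is orthogonal to `V`, so removing the `V`-component of `e` does not change its projection
  -- on `U`.
  have hUr : U.starProjection r = U.starProjection e := by
    rw [hre, map_sub, sub_eq_self, Submodule.starProjection_apply_eq_zero_iff]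
    exact fun w hw => Submodule.inner_left_of_mem_orthogonal (V.starProjection_apply_mem e) hw.1
  have h1 : ‖r - u‖ ≤ ‖m + e - z‖ := by
    have h2 : r - u = (m + e - z) - V.starProjection (m + e - z) := by
      rw [map_sub, hr, hu]; abel
    rw [h2]
    simpa using norm_sub_starProjection_le V (m + e - z) V.zero_mem
  calc ‖r‖ ^ 2 - ‖U.starProjection e‖ ^ 2 = ‖r - U.starProjection r‖ ^ 2 := by
        rw [norm_sub_starProjection_sq U r, hUr]
    _ ≤ ‖r - u‖ ^ 2 := by gcongr; exact norm_sub_starProjection_le U r huU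
    _ ≤ _ := by gcongr

/-- The span of a model together with the mean vector. -/
def meanSpan (x : ι → E) (m : E) (A : Finset ι) : Submodule ℝ E :=
  modelSpan x A ⊔ Submodule.span ℝ {m}

lemma finrank_meanSpan_le (x : ι → E) (m : E) (A : Finset ι) :
    Module.finrank ℝ (meanSpan x m A) ≤ A.card + 1 := by
  have h1 := Submodule.finrank_add_le_finrank_add_finrank (modelSpan x A) (Submodule.span ℝ {m})
  have h2 := finrank_modelSpan_le x A
  have h3 := finrank_span_le_card (R := ℝ) ({m} : Set E)
  simp only [Set.toFinset_singleton, Finset.card_singleton] at h3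
  rw [meanSpan]
  omega

lemma norm_starProjection_sq_le_of_le {U V : Submodule ℝ E} (h : U ≤ V) (e : E) :
    ‖U.starProjection e‖ ^ 2 ≤ ‖V.starProjection e‖ ^ 2 := by
  have h1 := norm_sub_starProjection_le V e (h (U.starProjection_apply_mem e))
  have h2 : ‖e - V.starProjection e‖ ^ 2 ≤ ‖e - U.starProjection e‖ ^ 2 := by gcongr
  rw [norm_sub_starProjection_sq, norm_sub_starProjection_sq] at h2
  linarith

/-- Residual sum of squares of an underfitted model. -/
lemma underfit_norm_sq_ge (x : ι → E) (m e : E) {A : Finset ι} {z : E} (hz : z ∈ modelSpan x A)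
    {c : ℝ} (hmis : c ≤ ‖m - (modelSpan x A).starProjection m‖ ^ 2)
    (he : 16 * ‖(meanSpan x m A).starProjection e‖ ^ 2 ≤ c) :
    ‖e‖ ^ 2 + c / 2 ≤ ‖m + e - z‖ ^ 2 := by
  set S := meanSpan x m A with hS
  set t := ‖m - z‖ with ht
  set s := ‖S.starProjection e‖ with hs
  have hct : c ≤ t ^ 2 :=
    hmis.trans (by rw [ht]; gcongr; exact norm_sub_starProjection_le _ m hz)
  have hst : 4 * s ≤ t := by
    refine le_of_sq_le_sq ?_ (norm_nonneg _)
    calc (4 * s) ^ 2 = 16 * s ^ 2 := by ring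
      _ ≤ t ^ 2 := he.trans hct
  -- Adjoining `m` to the model puts every possible bias `m - z` in one fixed subspace, so the cross
  -- term sees only the projection of the noise on it.
  have hmem : m - z ∈ S :=
    Submodule.sub_mem _ (Submodule.mem_sup_right (Submodule.mem_span_singleton_self m))
      (Submodule.mem_sup_left hz)
  have hin : -(s * t) ≤ ⟪e, m - z⟫ := by
    have h1 : ⟪e, m - z⟫ = ⟪S.starProjection e, m - z⟫ := by
      have := S.starProjection_inner_eq_zero e _ hmem
      rw [inner_sub_left, sub_eq_zero] at this
      exact this
    rw [h1]
    exact (abs_le.mp (abs_real_inner_le_norm _ _)).1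
  have hexp : ‖m + e - z‖ ^ 2 = ‖e‖ ^ 2 + 2 * ⟪e, m - z⟫ + t ^ 2 := by
    rw [ht, ← norm_add_sq_real]
    congr 2
    abel
  have ht0 : 0 ≤ t := norm_nonneg _
  -- The cross term then costs at most `2 * s * t ≤ t ^ 2 / 2`, half of the squared bias.
  have : s * t ≤ t / 4 * t := by gcongr; linarith
  rw [hexp]
  nlinarith

end ModelComparison

/-! ### Comparison of criterion values -/

/-- By `log x ≤ x - 1` the logarithm gains at most `d / r`. As `r ≥ v n / 8`, this is at most `8 s /
v` per extra variable in units of `L / n`, below the price `C`. -/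
lemma log_div_add_lt_of_overfit {r₀ r d n v s C L : ℝ} {q k : ℕ} (hn : 0 < n) (hv : 0 < v)
    (hL : 0 < L) (hqk : q < k) (hr₀ : v / 4 * n ≤ r₀) (hr : r₀ - d ≤ r)
    (hd0 : 0 ≤ d) (hd : d ≤ s * (k - q) * L) (hds : d ≤ v / 8 * n) (hC : 8 * s / v < C) :
    Real.log (r₀ / n) + q * (C * L / n) < Real.log (r / n) + k * (C * L / n) := by
  have hvn : 0 < v * n := by positivity
  have hr₀0 : 0 < r₀ := by linarith
  have hr0 : r₀ / 2 ≤ r := by linarith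
  have hrpos : 0 < r := by linarith
  have hk : (0 : ℝ) < k - q := sub_pos.mpr (by exact_mod_cast hqk)
  have h1 : Real.log (r₀ / n) - Real.log (r / n) ≤ r₀ / r - 1 := by
    rw [← Real.log_div (by positivity) (by positivity), div_div_div_cancel_right₀ hn.ne']
    exact Real.log_le_sub_one_of_pos (by positivity)
  have hCpos : 0 < (C - 8 * s / v) * ((k - q) * L / n) :=
    mul_pos (by linarith) (by positivity)
  have h2 : r₀ / r - 1 ≤ 8 * s / v * ((k - q) * L / n) := by
    rw [div_sub_one hrpos.ne', div_le_iff₀ hrpos]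
    have hsk : 8 * s / v * ((k - q) * L / n) = s * (k - q) * L * (8 / (v * n)) := by
      field_simp
    rw [hsk]
    have hr8 : v * n / 8 ≤ r := by linarith
    have h8 : 1 ≤ 8 / (v * n) * r := by
      rw [div_mul_eq_mul_div, le_div_iff₀ hvn]
      linarith
    have := le_mul_of_one_le_right (hd0.trans hd) h8
    linarith
  have h3 : (C - 8 * s / v) * ((k - q) * L / n)
      = k * (C * L / n) - q * (C * L / n) - 8 * s / v * ((k - q) * L / n) := by ring
  linarith

/-- Since `w ≤ B n`, an excess of `c n / 2` is a relative increase of at least `c / (2B)`, a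
constant gap in the logarithm. Here `w` stands for `‖ε‖²`. -/
lemma log_div_add_lt_of_underfit {r₀ r w n B c C L : ℝ} {q k : ℕ} (hn : 0 < n) (hr₀ : 0 < r₀)
    (hr₀w : r₀ ≤ w) (hw : w ≤ B * n) (hc : 0 < c) (hr : w + c * n / 2 ≤ r)
    (hC : 0 ≤ C) (hL : 0 ≤ L) (hq : q * C * L < Real.log (1 + c / (2 * B)) * n) :
    Real.log (r₀ / n) + q * (C * L / n) < Real.log (r / n) + k * (C * L / n) := by
  have hw0 : 0 < w := by linarith
  have hB : 0 < B := by
    by_contra hB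
    push Not at hB
    nlinarith
  have h1 : Real.log (1 + c / (2 * B)) + Real.log (r₀ / n) ≤ Real.log (r / n) := by
    rw [← Real.log_mul (by positivity) (by positivity)]
    apply Real.log_le_log (by positivity)
    calc (1 + c / (2 * B)) * (r₀ / n) ≤ (1 + c / (2 * B)) * (w / n) := by gcongr
      _ = w / n + c / (2 * B) * (w / n) := by ring
      _ ≤ w / n + c / (2 * B) * (B * n / n) := by gcongr
      _ = (w + c * n / 2) / n := by field_simp
      _ ≤ r / n := by gcongr
  have h2 : q * (C * L / n) < Real.log (1 + c / (2 * B)) := by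
    rw [← mul_div_assoc, div_lt_iff₀ hn]
    linarith
  have h3 : 0 ≤ k * (C * L / n) := by positivity
  linarith

/-! ### Transfer to the design matrix; selection on the good event -/

section Regression

variable {n p : ℕ} {X : Matrix (Fin n) (Fin p) ℝ} {β : Fin p → ℝ}

/-- The columns of a design matrix as Euclidean vectors. -/
def cols (X : Matrix (Fin n) (Fin p) ℝ) (j : Fin p) : EuclideanSpace ℝ (Fin n) :=
  WithLp.toLp 2 (X.col j)

lemma toLp_mulVec (X : Matrix (Fin n) (Fin p) ℝ) (β : Fin p → ℝ) :
    WithLp.toLp 2 (X *ᵥ β) = fit (cols X) β := by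
  ext i
  simp [fit, cols, Matrix.mulVec, dotProduct, mul_comm]

lemma sse_eq (X : Matrix (Fin n) (Fin p) ℝ) (y : Fin n → ℝ) (β : Fin p → ℝ) :
    sse X y β = ‖WithLp.toLp 2 y - fit (cols X) β‖ ^ 2 := by
  rw [sse, l2norm, WithLp.toLp_sub, toLp_mulVec]

lemma mem_supp {j : Fin p} : j ∈ supp β ↔ β j ≠ 0 := by simp [supp]

lemma eq_zero_of_notMem_supp {j : Fin p} (hj : j ∉ supp β) : β j = 0 := by
  simpa [mem_supp] using hj

lemma misfit_eq (X : Matrix (Fin n) (Fin p) ℝ) (β : Fin p → ℝ) (A : Finset (Fin p)) :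
    misfit X β A = ‖fit (cols X) β
      - (modelSpan (cols X) A).starProjection (fit (cols X) β)‖ ^ 2 / n := by
  have h : WithLp.toLp 2 (subCols X (supp β) *ᵥ fun j : supp β => β j) = fit (cols X) β := by
    rw [← toLp_mulVec]
    congr 1
    ext i
    simp only [Matrix.mulVec, dotProduct, subCols, Matrix.submatrix_apply, id]
    rw [Finset.sum_coe_sort (supp β) fun j => X i j * β j]
    refine Finset.sum_subset (Finset.subset_univ _) fun j _ hj => ?_
    rw [eq_zero_of_notMem_supp hj, mul_zero]
  rw [misfit, h]
  rfl

lemma minSignal_le {j : Fin p} (hj : j ∈ supp β) : minSignal β ≤ |β j| :=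
  csInf_le ⟨0, by rintro _ ⟨_, _, rfl⟩; exact abs_nonneg _⟩ ⟨j, mem_supp.mp hj, rfl⟩

lemma norm_cols_sq (hn : 0 < n) (hX : ∀ j, X.col j ⬝ᵥ X.col j / n = 1) (j : Fin p) :
    ‖cols X j‖ ^ 2 = n := by
  have h := hX j
  have hn' : (n : ℝ) ≠ 0 := by positivity
  rw [div_eq_one_iff_eq hn'] at h
  rw [← h, EuclideanSpace.norm_sq_eq]
  simp [cols, dotProduct, sq]

lemma restrictedEigen_cols (A : Finset (Fin p)) (hγ : 0 < restrictedEigenvalue X A) :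
    RestrictedEigen (cols X) A (restrictedEigenvalue X A ^ 2) n := by
  intro δ hδ
  have hA : l2norm (fun j : A => δ j) ^ 2 = ∑ j ∈ A, δ j ^ 2 := by
    rw [l2norm, EuclideanSpace.norm_sq_eq]
    simp only [Real.norm_eq_abs, sq_abs]
    exact Finset.sum_coe_sort A fun j => δ j ^ 2
  by_cases h0 : δ = 0
  · simp [h0, fit]
  have hle : restrictedEigenvalue X A ≤ l2norm (X *ᵥ δ) / (√n * l2norm (fun j : A => δ j)) := by
    refine csInf_le ⟨0, ?_⟩ ⟨δ, ⟨h0, hδ⟩, rfl⟩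
    rintro _ ⟨_, _, rfl⟩
    simp only [l2norm]
    positivity
  have hpos : 0 < √n * l2norm (fun j : A => δ j) := by
    -- A zero denominator would make the quotient `0` by convention, contradicting positivity of the
    -- infimum.
    refine lt_of_le_of_ne (mul_nonneg (Real.sqrt_nonneg _) (norm_nonneg _)) fun h => ?_
    rw [← h, div_zero] at hle
    linarith
  rw [le_div_iff₀ hpos] at hle
  calc restrictedEigenvalue X A ^ 2 * n * ∑ j ∈ A, δ j ^ 2
      = (restrictedEigenvalue X A * (√n * l2norm (fun j : A => δ j))) ^ 2 := by
        rw [mul_pow, mul_pow, hA, Real.sq_sqrt (Nat.cast_nonneg _)]; ring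
    _ ≤ l2norm (X *ᵥ δ) ^ 2 := by gcongr
    _ = ‖fit (cols X) δ‖ ^ 2 := by rw [l2norm, toLp_mulVec]

/-- Along the calibrated path, the fit at a suitable tuning parameter is the least squares fit of
the true model. -/
theorem path_oracle {pen : ℝ → ℝ → ℝ} {a b l τ : ℝ} (hpen : PenaltyCondition pen a b)
    (hn : 0 < n) (hX : ∀ j, X.col j ⬝ᵥ X.col j / n = 1)
    (hγ : 0 < restrictedEigenvalue X (supp β)) (hl : 0 < l) (hτ : 0 < τ) (hτ1 : τ ≤ 1 / 2)
    (hηb : 9 * τ * (supp β).card / restrictedEigenvalue X (supp β) ^ 2 ≤ b)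
    (hη : 9 * τ * (supp β).card / restrictedEigenvalue X (supp β) ^ 2 ≤ 1 / 4)
    (hd : (a + 1) * l < minSignal β) {e y : Fin n → ℝ} (hy : y = X *ᵥ β + e)
    (he : ∀ j, |⟪cols X j, WithLp.toLp 2 e⟫| ≤ n * (τ * l) / 2)
    {path : ℝ → Fin p → ℝ} (hpath : IsCalibratedPath pen τ X y path) :
    supp (path l) = supp β ∧
      sse X y (path l) = ‖WithLp.toLp 2 y
        - (modelSpan (cols X) (supp β)).starProjection (WithLp.toLp 2 y)‖ ^ 2 := by
  obtain ⟨b₁, h₁, h₂⟩ := hpath l hl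
  have hy' : WithLp.toLp 2 y = fit (cols X) β + WithLp.toLp 2 e := by
    rw [hy, WithLp.toLp_add, toLp_mulVec]
  -- The linear term vanishes at the starting value `0`, so the first iterate is a plain Lasso.
  have hJ0 : deriv (concavePart pen (τ * l)) 0 = 0 := by
    have := hpen.deriv_small (τ * l) (by positivity) 0 (by
      rw [abs_zero]; exact mul_nonneg hpen.b_pos.le (by positivity))
    simpa using this
  obtain ⟨hs, horth⟩ := cccp_oracle (restrictedEigen_cols (supp β) hγ) (by positivity)
    (by positivity : (0 : ℝ) < n) (norm_cols_sq hn hX) hl hτ hτ1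
    (by linarith [hpen.one_lt_a] : 0 < a) hηb hη
    (fun j hj => eq_zero_of_notMem_supp hj) (fun j hj => hd.trans_le (minSignal_le hj))
    (hpen.deriv_large l hl) (hpen.deriv_small l hl) he (b₁ := b₁) (b₂ := path l)
    (fun c => by
      have := h₁ (Set.mem_univ c)
      simpa [Q, sse_eq, hy', hJ0] using this)
    (fun c => by
      have := h₂ (Set.mem_univ c)
      simpa [Q, sse_eq, hy'] using this)
  have hsupp : supp (path l) = supp β := by
    ext j
    rw [mem_supp, hs]
  refine ⟨hsupp, ?_⟩
  rw [sse_eq]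
  have hmem : fit (cols X) (path l) ∈ modelSpan (cols X) (supp β) :=
    fit_mem_span (cols X) fun j hj => eq_zero_of_notMem_supp (by rwa [hsupp])
  rw [Submodule.eq_starProjection_of_mem_of_inner_eq_zero hmem]
  intro w hw
  induction hw using Submodule.span_induction with
  | mem w hw =>
    obtain ⟨j, rfl⟩ := hw
    rw [real_inner_comm, hy']
    exact horth j j.2
  | zero => simp
  | add u w _ _ hu hw => rw [inner_add_right, hu, hw, add_zero]
  | smul c u _ hu => rw [real_inner_smul_right, hu, mul_zero]

/-- Selection consistency of the HBIC on an event described by the size of projections of the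
noise. -/
theorem hbic_selects_of_events {l₀ s v κ B C : ℝ} {K : ℕ} (hn : 0 < n)
    {e y : Fin n → ℝ} (hy : y = X *ᵥ β + e) {path : ℝ → Fin p → ℝ} (hl₀ : 0 < l₀)
    (hsupp : supp (path l₀) = supp β)
    (hsse : sse X y (path l₀) = ‖WithLp.toLp 2 y
        - (modelSpan (cols X) (supp β)).starProjection (WithLp.toLp 2 y)‖ ^ 2)
    (hK : (supp β).card < K)
    (hover : ∀ D : Finset (Fin p), D.Nonempty →
      ‖(extraSpan (cols X) (supp β) (supp β ∪ D)).starProjection (WithLp.toLp 2 e)‖ ^ 2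
        ≤ s * D.card * Real.log p)
    (hunder : ∀ A : Finset (Fin p),
      ‖(meanSpan (cols X) (fit (cols X) β) A).starProjection (WithLp.toLp 2 e)‖ ^ 2
        ≤ s * (A.card + 1) * Real.log p)
    (he : v / 2 * n ≤ ‖WithLp.toLp 2 e‖ ^ 2) (heB : ‖WithLp.toLp 2 e‖ ^ 2 ≤ B * n)
    (hmis : ∀ A : Finset (Fin p), ¬ supp β ⊆ A → A.card ≤ K → κ ≤ misfit X β A)
    (hs : 0 < s) (hv : 0 < v) (hκ : 0 < κ) (hp : 0 < Real.log p)
    (hKv : s * (K + 1) * Real.log p ≤ v / 8 * n) (hKκ : s * (K + 1) * Real.log p ≤ κ / 16 * n)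
    (hC : 8 * s / v < C)
    (hqC : (supp β).card * C * Real.log p < Real.log (1 + κ / (2 * B)) * n) :
    (∃ l, IsHBICChoice C K X y path l) ∧
      ∀ l, IsHBICChoice C K X y path l → supp (path l) = supp β := by
  set m := fit (cols X) β with hm
  set E := (WithLp.toLp 2 e : EuclideanSpace ℝ (Fin n)) with hE
  set V := modelSpan (cols X) (supp β) with hV
  have hn' : (0 : ℝ) < n := by positivity
  have hC0 : 0 < C := lt_trans (by positivity) hC
  have hy' : WithLp.toLp 2 y = m + E := by
    rw [hy, WithLp.toLp_add, toLp_mulVec]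
  have hmV : m ∈ V := fit_mem_span (cols X) fun j hj => eq_zero_of_notMem_supp hj
  have hR : ∀ k : ℕ, k ≤ K → s * (k + 1) * Real.log p ≤ s * (K + 1) * Real.log p := by
    intro k hk
    have : (k : ℝ) ≤ K := by exact_mod_cast hk
    gcongr
  set r₀ := sse X y (path l₀) with hr₀_def
  have hr₀ : r₀ = ‖E‖ ^ 2 - ‖V.starProjection E‖ ^ 2 := by
    rw [hsse, hy', sub_starProjection_eq_of_mem V hmV, norm_sub_starProjection_sq]
  -- The true model's span lies in its own `meanSpan`, so the underfitting event also controls the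
  -- oracle residual.
  have hPE : ‖V.starProjection E‖ ^ 2 ≤ v / 8 * n :=
    (norm_starProjection_sq_le_of_le le_sup_left E).trans
      ((hunder (supp β)).trans ((hR _ hK.le).trans hKv))
  have hr₀v : v / 4 * n ≤ r₀ := by
    have : 0 < v * n := by positivity
    rw [hr₀]; linarith
  have hr₀pos : 0 < r₀ := lt_of_lt_of_le (by positivity) hr₀v
  have hcmp : ∀ l ∈ tuningSet K path, hbic C X y (path l₀) ≤ hbic C X y (path l) ∧
      (supp (path l) ≠ supp β → hbic C X y (path l₀) < hbic C X y (path l)) := by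
    rintro l ⟨-, hcard⟩
    have hz : fit (cols X) (path l) ∈ modelSpan (cols X) (supp (path l)) :=
      fit_mem_span (cols X) fun j hj => eq_zero_of_notMem_supp hj
    have hlt : supp (path l) ≠ supp β → hbic C X y (path l₀) < hbic C X y (path l) := by
      intro hne
      rw [hbic, hbic, hsupp]
      by_cases hsub : supp β ⊆ supp (path l)
      · have hD : (supp (path l) \ supp β).Nonempty :=
          Finset.sdiff_nonempty.mpr fun h => hne (h.antisymm hsub)
        have hDc : ((supp (path l) \ supp β).card : ℝ)
            = (supp (path l)).card - (supp β).card := by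
          rw [Finset.card_sdiff_of_subset hsub, Nat.cast_sub (Finset.card_le_card hsub)]
        have ho := hover _ hD
        rw [Finset.union_sdiff_of_subset hsub, hDc] at ho
        have hge := overfit_norm_sq_ge (e := E) (cols X) hmV hsub hz
        rw [← hy', ← hsse, ← sse_eq] at hge
        refine log_div_add_lt_of_overfit hn' hv hp
          (Finset.card_lt_card (hsub.ssubset_of_ne hne.symm)) hr₀v hge (sq_nonneg _) ho ?_ hC
        refine ho.trans (le_trans ?_ ((hR _ hcard).trans hKv))
        have : (0 : ℝ) ≤ (supp β).card := Nat.cast_nonneg _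
        gcongr
        linarith
      · have hmisA := hmis _ hsub hcard
        rw [misfit_eq, le_div_iff₀ hn'] at hmisA
        have hge := underfit_norm_sq_ge (cols X) m E hz hmisA
          (by linarith [hunder (supp (path l)), hR _ hcard])
        rw [← hy', ← sse_eq] at hge
        exact log_div_add_lt_of_underfit hn' hr₀pos
          (by linarith [sq_nonneg ‖V.starProjection E‖]) heB hκ hge hC0.le hp.le hqC
    refine ⟨?_, hlt⟩
    by_cases heq : supp (path l) = supp β
    · rw [hbic, hbic, hsupp, heq]
      have : r₀ ≤ sse X y (path l) := by
        rw [hsse, sse_eq]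
        rw [heq] at hz
        gcongr
        exact norm_sub_starProjection_le _ _ hz
      gcongr
    · exact (hlt heq).le
  have hmem : l₀ ∈ tuningSet K path := ⟨hl₀, by rw [hsupp]; exact hK.le⟩
  refine ⟨⟨l₀, hmem, fun l hl => (hcmp l hl).1⟩, fun l hl => ?_⟩
  by_contra hne
  exact absurd (hl.2 hmem) (not_le.mpr ((hcmp l hl.1).2 hne))

end Regression

/-! ### Union bounds over columns and over all models -/

section UnionBounds

lemma measure_exists_le_sum {Ω ι : Type*} [MeasurableSpace Ω] {μ : Measure Ω} [Fintype ι] {S : ι → Set Ω} {f : ι → ℝ}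
    (hf : ∀ i, 0 ≤ f i) (h : ∀ i, μ (S i) ≤ ENNReal.ofReal (f i)) :
    μ {ω | ∃ i, ω ∈ S i} ≤ ENNReal.ofReal (∑ i, f i) := by
  rw [ENNReal.ofReal_sum_of_nonneg fun i _ => hf i]
  have : {ω | ∃ i, ω ∈ S i} = ⋃ i, S i := by ext; simp
  rw [this]
  exact (measure_iUnion_fintype_le _ _).trans (Finset.sum_le_sum fun i _ => h i)

variable {Ω : Type*} [MeasurableSpace Ω] {μ : Measure Ω} [SFinite μ] {n p : ℕ}
  {ε : Fin n → Ω → ℝ} {σ : ℝ≥0}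

lemma measure_exists_inner_gt_le (hσ : 0 < σ) (h_indep : iIndepFun ε μ)
    (h_subG : ∀ i, HasSubgaussianMGF (ε i) (σ ^ 2) μ)
    {x : Fin p → EuclideanSpace ℝ (Fin n)} (hn : 0 < n) (hx : ∀ j, ‖x j‖ ^ 2 = n) {u : ℝ}
    (hu : 0 < u) :
    μ {ω | ∃ j, n * u / 2 < |⟪x j, WithLp.toLp 2 fun i => ε i ω⟫|}
      ≤ ENNReal.ofReal (p * (2 * Real.exp (-(n * u ^ 2 / (16 * (σ : ℝ) ^ 2))))) := by
  have hσ' : (0 : ℝ) < σ := NNReal.coe_pos.mpr hσ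
  have hn' : (0 : ℝ) < n := by positivity
  refine (measure_exists_le_sum (S := fun j => {ω | n * u / 2 <
    |⟪x j, WithLp.toLp 2 fun i => ε i ω⟫|})
    (f := fun _ => 2 * Real.exp (-(n * u ^ 2 / (16 * (σ : ℝ) ^ 2)))) (fun j => by positivity)
    fun j => ?_).trans (by simp)
  have hd : Module.finrank ℝ (Submodule.span ℝ {x j}) ≤ 1 := by
    simpa using finrank_span_le_card (R := ℝ) ({x j} : Set (EuclideanSpace ℝ (Fin n)))
  have h := measure_noise_projection_le hσ h_indep h_subG _ hd (n * u ^ 2 / (16 * (σ : ℝ) ^ 2))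
  rw [pow_one] at h
  refine (measure_mono fun ω hω => ?_).trans h
  simp only [Set.mem_ofPred_eq] at hω ⊢
  set e : EuclideanSpace ℝ (Fin n) := WithLp.toLp 2 fun i => ε i ω
  set W := Submodule.span ℝ {x j}
  have h1 : ⟪x j, e⟫ = ⟪x j, W.starProjection e⟫ := by
    have := W.starProjection_inner_eq_zero e _ (Submodule.mem_span_singleton_self (x j))
    rw [inner_sub_left, sub_eq_zero] at this
    rw [real_inner_comm, this, real_inner_comm]
  have h2 : (n * u / 2) ^ 2 ≤ n * ‖W.starProjection e‖ ^ 2 := by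
    calc (n * u / 2) ^ 2 ≤ |⟪x j, e⟫| ^ 2 := by gcongr
      _ ≤ (‖x j‖ * ‖W.starProjection e‖) ^ 2 := by
          rw [h1]
          gcongr
          exact abs_real_inner_le_norm _ _
      _ = _ := by rw [mul_pow, hx]
  have h3 : 4 * (σ : ℝ) ^ 2 * (n * u ^ 2 / (16 * (σ : ℝ) ^ 2)) = n * u ^ 2 / 4 := by
    field_simp; norm_num
  rw [h3]
  refine le_of_mul_le_mul_left ?_ hn'
  linarith [h2]

/-- By the binomial theorem the sum is `(x + 1) ^ p`; this handles all model sizes together. -/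
lemma sum_pow_card_le {x : ℝ} (hx : 0 ≤ x) :
    ∑ D : Finset (Fin p), x ^ D.card ≤ Real.exp (p * x) := by
  have h := Fintype.sum_pow_mul_eq_add_pow (Fin p) x 1
  simp only [one_pow, mul_one, Fintype.card_fin] at h
  rw [h, Real.exp_nat_mul]
  exact pow_le_pow_left₀ (by positivity) (Real.add_one_le_exp x) p

/-- Excluding `D = ∅`, whose term would be `1`, produces the `- 1` that lets the bound tend to zero.
-/
lemma measure_exists_nonempty_projection_gt_le (hσ : 0 < σ) (h_indep : iIndepFun ε μ)
    (h_subG : ∀ i, HasSubgaussianMGF (ε i) (σ ^ 2) μ)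
    (W : Finset (Fin p) → Submodule ℝ (EuclideanSpace ℝ (Fin n)))
    (hW : ∀ D, Module.finrank ℝ (W D) ≤ D.card) (t : ℝ) :
    μ {ω | ∃ D : Finset (Fin p), D.Nonempty ∧ 4 * (σ : ℝ) ^ 2 * (D.card * t)
        < ‖(W D).starProjection (WithLp.toLp 2 fun i => ε i ω)‖ ^ 2}
      ≤ ENNReal.ofReal (Real.exp (p * (2 * Real.exp (-t))) - 1) := by
  have hpow : ∀ k : ℕ, (2 : ℝ) ^ k * Real.exp (-(k * t)) = (2 * Real.exp (-t)) ^ k := by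
    intro k
    rw [mul_pow, ← Real.exp_nat_mul]; ring_nf
  refine (measure_exists_le_sum (S := fun D => {ω | D.Nonempty ∧ 4 * (σ : ℝ) ^ 2 * (D.card * t)
        < ‖(W D).starProjection (WithLp.toLp 2 fun i => ε i ω)‖ ^ 2})
    (f := fun D => if D.Nonempty then (2 * Real.exp (-t)) ^ D.card else 0)
    (fun D => by split_ifs <;> positivity) fun D => ?_).trans ?_
  · split_ifs with hD
    · rw [← hpow]
      refine (measure_mono fun ω hω => ?_).trans
        (measure_noise_projection_le hσ h_indep h_subG (W D) (hW D) _)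
      exact hω.2.le
    · simp [hD]
  · apply ENNReal.ofReal_le_ofReal
    have h1 : ∀ D : Finset (Fin p), (if D.Nonempty then (2 * Real.exp (-t)) ^ D.card else 0)
        = (2 * Real.exp (-t)) ^ D.card - if D = ∅ then 1 else 0 := by
      intro D
      rcases D.eq_empty_or_nonempty with rfl | hD
      · simp
      · simp [hD, hD.ne_empty]
    simp_rw [h1]
    rw [Finset.sum_sub_distrib]
    have := sum_pow_card_le (p := p) (x := 2 * Real.exp (-t)) (by positivity)
    simpa using this

/-- The extra dimension supplies a factor `2 * exp (-t)`, so here the empty set may stay in the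
union. -/
lemma measure_exists_projection_gt_le (hσ : 0 < σ) (h_indep : iIndepFun ε μ)
    (h_subG : ∀ i, HasSubgaussianMGF (ε i) (σ ^ 2) μ)
    (W : Finset (Fin p) → Submodule ℝ (EuclideanSpace ℝ (Fin n)))
    (hW : ∀ D, Module.finrank ℝ (W D) ≤ D.card + 1) (t : ℝ) :
    μ {ω | ∃ D : Finset (Fin p), 4 * (σ : ℝ) ^ 2 * ((D.card + 1) * t)
        < ‖(W D).starProjection (WithLp.toLp 2 fun i => ε i ω)‖ ^ 2}
      ≤ ENNReal.ofReal (Real.exp (p * (2 * Real.exp (-t))) * (2 * Real.exp (-t))) := by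
  have hpow : ∀ k : ℕ, (2 : ℝ) ^ (k + 1) * Real.exp (-((k + 1) * t))
      = (2 * Real.exp (-t)) ^ k * (2 * Real.exp (-t)) := by
    intro k
    rw [← pow_succ, mul_pow, ← Real.exp_nat_mul]
    push_cast
    ring_nf
  refine (measure_exists_le_sum (S := fun D => {ω | 4 * (σ : ℝ) ^ 2 * ((D.card + 1) * t)
        < ‖(W D).starProjection (WithLp.toLp 2 fun i => ε i ω)‖ ^ 2})
    (f := fun D => (2 * Real.exp (-t)) ^ D.card * (2 * Real.exp (-t)))
    (fun D => by positivity) fun D => ?_).trans ?_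
  · have h := measure_noise_projection_le hσ h_indep h_subG (W D) (hW D) ((D.card + 1) * t)
    rw [hpow] at h
    refine le_trans (measure_mono fun ω hω => ?_) h
    simp only [Set.mem_ofPred_eq] at hω ⊢
    exact hω.le
  · apply ENNReal.ofReal_le_ofReal
    rw [← Finset.sum_mul]
    gcongr
    exact sum_pow_card_le (by positivity)

end UnionBounds

/-! ### Asymptotics of the error bounds -/

section Limits

variable {p : ℕ → ℕ}

lemma tendsto_log_natCast (hp : Tendsto p atTop atTop) :
    Tendsto (fun n => Real.log (p n)) atTop atTop :=
  Real.tendsto_log_atTop.comp (tendsto_natCast_atTop_atTop.comp hp)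

lemma tendsto_exp_neg_log (hp : Tendsto p atTop atTop) {c : ℝ} (hc : 0 < c) :
    Tendsto (fun n => 2 * Real.exp (-(c * Real.log (p n)))) atTop (𝓝 0) := by
  simpa using (Real.tendsto_exp_neg_atTop_nhds_zero.comp
    ((tendsto_log_natCast hp).const_mul_atTop hc)).const_mul 2

lemma tendsto_exp_union (hp : Tendsto p atTop atTop) :
    Tendsto (fun n => Real.exp (p n * (2 * Real.exp (-(3 * Real.log (p n)))))) atTop (𝓝 1) := by
  have h : Tendsto (fun n => (p n : ℝ) * (2 * Real.exp (-(3 * Real.log (p n))))) atTop (𝓝 0) := by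
    refine (tendsto_exp_neg_log hp two_pos).congr' ?_
    filter_upwards [hp.eventually_ge_atTop 1] with n hn
    have hpos : (0 : ℝ) < p n := by exact_mod_cast hn
    have h3 : Real.exp (-(3 * Real.log (p n)))
        = Real.exp (-(2 * Real.log (p n))) * (p n : ℝ)⁻¹ := by
      rw [← Real.exp_log (inv_pos.mpr hpos), ← Real.exp_add, Real.log_inv]
      ring_nf
    rw [h3]
    field_simp
  have h1 := (Real.continuous_exp.tendsto 0).comp h
  rwa [Real.exp_zero] at h1

/-- Eventually `log p ≤ r / (2c)`, so half of the exponent absorbs the factor `p`. -/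
lemma tendsto_mul_exp_neg_of_isLittleO (hp : Tendsto p atTop atTop) {r : ℕ → ℝ}
    (hr : Tendsto r atTop atTop) (hlog : (fun n => Real.log (p n)) =o[atTop] r) {c : ℝ}
    (hc : 0 < c) :
    Tendsto (fun n => (p n : ℝ) * (2 * Real.exp (-(r n / c)))) atTop (𝓝 0) := by
  have h0 : Tendsto (fun n => 2 * Real.exp (-(r n / (2 * c)))) atTop (𝓝 0) := by
    simpa using (Real.tendsto_exp_neg_atTop_nhds_zero.comp
      (hr.atTop_div_const (by positivity : 0 < 2 * c))).const_mul 2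
  refine squeeze_zero' (Eventually.of_forall fun n => by positivity) ?_ h0
  filter_upwards [hp.eventually_ge_atTop 1, hr.eventually_ge_atTop 0,
    hlog.bound (by positivity : 0 < 1 / (2 * c))] with n hn hrn hb
  have hpos : (0 : ℝ) < p n := by exact_mod_cast hn
  rw [Real.norm_eq_abs, Real.norm_of_nonneg hrn] at hb
  have h1 := (le_abs_self _).trans hb
  calc (p n : ℝ) * (2 * Real.exp (-(r n / c)))
      = 2 * Real.exp (Real.log (p n) + -(r n / c)) := by
        rw [Real.exp_add, Real.exp_log hpos]; ring
    _ ≤ 2 * Real.exp (-(r n / (2 * c))) := by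
        gcongr
        have h2 : r n / c = 1 / (2 * c) * r n + r n / (2 * c) := by field_simp; norm_num
        rw [h2]
        linarith

lemma eventually_mul_log_le (hp : Tendsto p atTop atTop) {K : ℕ → ℕ}
    (hK : ∀ᶠ n in atTop, 0 < K n)
    (hK2 : (fun n : ℕ => (K n : ℝ) ^ 2 * Real.log (p n) * Real.log n)
      =o[atTop] fun n : ℕ => (n : ℝ)) {s c : ℝ} (hs : 0 < s) (hc : 0 < c) :
    ∀ᶠ n : ℕ in atTop, s * (K n + 1) * Real.log (p n) ≤ c * n := by
  filter_upwards [hK, hK2.bound (by positivity : 0 < c / (2 * s)),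
    (tendsto_log_natCast hp).eventually_ge_atTop 0,
    (Real.tendsto_log_atTop.comp tendsto_natCast_atTop_atTop).eventually_ge_atTop 1]
    with n hK hb hL hlog
  have hK' : (1 : ℝ) ≤ K n := by exact_mod_cast hK
  have hlog' : (1 : ℝ) ≤ Real.log n := hlog
  rw [Real.norm_eq_abs, Real.norm_of_nonneg (Nat.cast_nonneg n)] at hb
  have h1 := (le_abs_self _).trans hb
  have h2 : (K n + 1) * Real.log (p n) ≤ 2 * ((K n : ℝ) ^ 2 * Real.log (p n) * Real.log n) := by
    calc (K n + 1) * Real.log (p n) ≤ 2 * (K n : ℝ) ^ 2 * Real.log (p n) := by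
          gcongr
          nlinarith
      _ ≤ 2 * (K n : ℝ) ^ 2 * Real.log (p n) * Real.log n :=
          le_mul_of_one_le_right (by positivity) hlog'
      _ = _ := by ring
  calc s * (K n + 1) * Real.log (p n) = s * ((K n + 1) * Real.log (p n)) := by ring
    _ ≤ s * (2 * (c / (2 * s) * n)) := by refine mul_le_mul_of_nonneg_left ?_ hs.le; exact h2.trans (by linarith)
    _ = c * n := by field_simp

lemma minSignal_nonneg {p : ℕ} (β : Fin p → ℝ) : 0 ≤ minSignal β :=
  Real.sInf_nonneg (by rintro _ ⟨_, _, rfl⟩; exact abs_nonneg _)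

lemma eventually_mul_lt_of_isLittleO {f g : ℕ → ℝ} (h : f =o[atTop] g) {c : ℝ} (hc : 0 < c)
    (hg : ∀ᶠ n in atTop, 0 < g n) : ∀ᶠ n in atTop, f n < c * g n := by
  filter_upwards [h.bound (half_pos hc), hg] with n hn hgn
  rw [Real.norm_eq_abs, Real.norm_of_nonneg hgn.le] at hn
  have := (le_abs_self _).trans hn
  have := mul_pos hc hgn
  linarith

end Limits

end HBIC

/-! ### Assembly of the consistency theorem -/

open HBIC in
theorem theorem2
    -- dimensions, nonstochastic designs with normalized columns, true nonzero coefficients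
    (p : ℕ → ℕ) (X : ∀ n, Matrix (Fin n) (Fin (p n)) ℝ) (βstar : ∀ n, Fin (p n) → ℝ)
    (hp : Tendsto p atTop atTop)
    (hX : ∀ᶠ n : ℕ in atTop, ∀ j, (X n).col j ⬝ᵥ (X n).col j / n = 1)
    (hβ : ∀ᶠ n in atTop, (HBIC.supp (βstar n)).Nonempty)
    -- random errors: within each row i.i.d., mean zero, sub-Gaussian, non-degenerate
    {Ω : ℕ → Type*} [∀ n, MeasurableSpace (Ω n)] (P : ∀ n, Measure (Ω n))
    [∀ n, IsProbabilityMeasure (P n)] (ε : ∀ n, Fin n → Ω n → ℝ)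
    (σ : ℝ≥0) (v : ℝ) (hσ : 0 < σ) (hv : 0 < v)
    (h_indep : ∀ n, iIndepFun (ε n) (P n))
    (h_ident : ∀ n i j, IdentDistrib (ε n i) (ε n j) (P n) (P n))
    (h_mean : ∀ n i, ∫ ω, ε n i ω ∂(P n) = 0)
    (h_subG : ∀ n i, HasSubgaussianMGF (ε n i) (σ ^ 2) (P n))
    (h_var : ∀ n i, v ≤ Var[ε n i; P n])
    -- smallest eigenvalue of the Gram matrix of the true model
    (C₁ : ℝ) (hC₁ : 0 < C₁)
    (hA1 : ∀ᶠ n : ℕ in atTop, C₁ ≤ HBIC.lambdaMin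
      ((n : ℝ)⁻¹ • ((HBIC.subCols (X n) (HBIC.supp (βstar n)))ᵀ *
        HBIC.subCols (X n) (HBIC.supp (βstar n)))))
    -- the penalty
    (pen : ℝ → ℝ → ℝ) (a b : ℝ) (hA3 : HBIC.PenaltyCondition pen a b)
    -- the restricted eigenvalue constant
    (hA4 : ∀ᶠ n in atTop, 0 < HBIC.restrictedEigenvalue (X n) (HBIC.supp (βstar n)))
    -- the tuning parameters for which the path is consistent
    (lam τ : ℕ → ℝ) (h_lam : ∀ n, 0 < lam n) (hτ : ∀ n, 0 < τ n)
    (hA5_lam : lam =o[atTop] fun n => HBIC.minSignal (βstar n))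
    (hA5_τ : Tendsto τ atTop (𝓝 0))
    (h_rate : Tendsto (fun n : ℕ => (n : ℝ) * τ n ^ 2 * lam n ^ 2) atTop atTop)
    (h_logp : (fun n => Real.log (p n)) =o[atTop] fun n : ℕ => (n : ℝ) * τ n ^ 2 * lam n ^ 2)
    (h_γ : Tendsto (fun n => τ n *
      (HBIC.restrictedEigenvalue (X n) (HBIC.supp (βstar n)) ^ 2)⁻¹ *
      (HBIC.supp (βstar n)).card) atTop (𝓝 0))
    -- model size bound, identifiability, and rates for the HBIC
    (K : ℕ → ℕ) (C : ℕ → ℝ) (κ : ℝ) (hκ : 0 < κ)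
    (hK : ∀ᶠ n in atTop, (HBIC.supp (βstar n)).card < K n)
    (h_iden : ∀ κ' < κ, ∀ᶠ n in atTop, ∀ A : Finset (Fin (p n)),
      ¬ HBIC.supp (βstar n) ⊆ A → A.card ≤ K n → κ' ≤ HBIC.misfit (X n) (βstar n) A)
    (hC : Tendsto C atTop atTop)
    (hqC : (fun n => ((HBIC.supp (βstar n)).card : ℝ) * C n * Real.log (p n))
      =o[atTop] fun n : ℕ => (n : ℝ))
    (hK2 : (fun n : ℕ => (K n : ℝ) ^ 2 * Real.log (p n) * Real.log n)
      =o[atTop] fun n : ℕ => (n : ℝ))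
    -- the response and the calibrated CCCP path
    (y : ∀ n, Ω n → Fin n → ℝ)
    (hy : ∀ n ω, y n ω = X n *ᵥ βstar n + fun i => ε n i ω)
    (path : ∀ n, Ω n → ℝ → Fin (p n) → ℝ)
    (h_path : ∀ n ω, HBIC.IsCalibratedPath pen (τ n) (X n) (y n ω) (path n ω)) :
    -- with (inner) probability tending to one an HBIC choice exists and every HBIC choice
    -- identifies exactly the true model
    Tendsto (fun n => P n {ω | ¬ ((∃ l, HBIC.IsHBICChoice (C n) (K n) (X n) (y n ω) (path n ω) l) ∧
      ∀ l, HBIC.IsHBICChoice (C n) (K n) (X n) (y n ω) (path n ω) l →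
        HBIC.supp (path n ω l) = HBIC.supp (βstar n))}) atTop (𝓝 0) := by
  have hσ' : (0 : ℝ) < σ := NNReal.coe_pos.mpr hσ
  -- This is `4σ² * 3`, from the level `t = 3 log p`; any multiple of `log p` above `1` would make
  -- `p * exp (-t)` vanish.
  set s : ℝ := 12 * (σ : ℝ) ^ 2 with hs_def
  have hs : 0 < s := by positivity
  set M : ℝ := 48 * Real.exp ((σ : ℝ) ^ 2 / 2) with hM_def
  set B : ℝ := 1 + M + v / 2 with hB_def
  have hB : 0 < B := by positivity
  have ha1 : 0 < a + 1 := by linarith [hA3.one_lt_a]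
  have hlog1 : 0 < Real.log (1 + κ / 2 / (2 * B)) :=
    Real.log_pos (by linarith [(by positivity : 0 < κ / 2 / (2 * B))])
  -- bounds for the probabilities of the four exceptional events
  set f₁ : ℕ → ℝ := fun n =>
    p n * (2 * Real.exp (-((n : ℝ) * τ n ^ 2 * lam n ^ 2 / (16 * (σ : ℝ) ^ 2)))) with hf₁
  set f₂ : ℕ → ℝ := fun n =>
    Real.exp (p n * (2 * Real.exp (-(3 * Real.log (p n))))) - 1 with hf₂
  set f₃ : ℕ → ℝ := fun n => Real.exp (p n * (2 * Real.exp (-(3 * Real.log (p n)))))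
    * (2 * Real.exp (-(3 * Real.log (p n)))) with hf₃
  set f₄ : ℕ → ℝ := fun n => M / (v / 2) ^ 2 * (n : ℝ)⁻¹ with hf₄
  have ht₁ : Tendsto f₁ atTop (𝓝 0) :=
    tendsto_mul_exp_neg_of_isLittleO hp h_rate h_logp (by positivity)
  have ht₂ : Tendsto f₂ atTop (𝓝 0) := by
    simpa using (tendsto_exp_union hp).sub_const 1
  have ht₃ : Tendsto f₃ atTop (𝓝 0) := by
    simpa using (tendsto_exp_union hp).mul (tendsto_exp_neg_log hp three_pos)
  have ht₄ : Tendsto f₄ atTop (𝓝 0) := by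
    simpa using (tendsto_inv_atTop_nhds_zero_nat (𝕜 := ℝ)).const_mul (M / (v / 2) ^ 2)
  have hofReal : ∀ {f : ℕ → ℝ}, Tendsto f atTop (𝓝 0) →
      Tendsto (fun n => ENNReal.ofReal (f n)) atTop (𝓝 0) := fun hf => by
    simpa using ENNReal.tendsto_ofReal hf
  have hlim : Tendsto (fun n => ENNReal.ofReal (f₁ n) + ENNReal.ofReal (f₂ n)
      + ENNReal.ofReal (f₃ n) + ENNReal.ofReal (f₄ n)) atTop (𝓝 0) := by
    simpa using (((hofReal ht₁).add (hofReal ht₂)).add (hofReal ht₃)).add (hofReal ht₄)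
  refine tendsto_of_tendsto_of_tendsto_of_le_of_le' tendsto_const_nhds hlim
    (Eventually.of_forall fun _ => zero_le) ?_
  have hη : ∀ c : ℝ, 0 < c → ∀ᶠ n in atTop, 9 * τ n * (supp (βstar n)).card
      / restrictedEigenvalue (X n) (supp (βstar n)) ^ 2 ≤ c := by
    intro c hc
    filter_upwards [h_γ.eventually_le_const (by positivity : 0 < c / 9)] with n hn
    calc _ = 9 * (τ n * (restrictedEigenvalue (X n) (supp (βstar n)) ^ 2)⁻¹
          * (supp (βstar n)).card) := by rw [div_eq_mul_inv]; ring
      _ ≤ c := by linarith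
  have hsig : ∀ᶠ n in atTop, (a + 1) * lam n < minSignal (βstar n) := by
    filter_upwards [hA5_lam.bound (by positivity : 0 < 1 / (2 * (a + 1)))] with n hn
    rw [Real.norm_of_nonneg (h_lam n).le, Real.norm_of_nonneg (minSignal_nonneg _)] at hn
    have h1 : (a + 1) * lam n ≤ minSignal (βstar n) / 2 := by
      calc (a + 1) * lam n ≤ (a + 1) * (1 / (2 * (a + 1)) * minSignal (βstar n)) := by gcongr
        _ = _ := by field_simp
    have h2 : 0 < (a + 1) * lam n := mul_pos ha1 (h_lam n)
    linarith
  have hKpos : ∀ᶠ n in atTop, 0 < K n := hK.mono fun n hn => by omega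
  filter_upwards [eventually_gt_atTop 0, hX, hA4, hη b hA3.b_pos, hη (1 / 4) (by norm_num), hsig,
    hA5_τ.eventually_le_const (by norm_num : (0 : ℝ) < 1 / 2), hK,
    -- A lower limit of at least `κ` yields only constants below `κ` eventually; `κ / 2` serves from
    -- here on.
    h_iden (κ / 2) (by linarith),
    hC.eventually_gt_atTop (8 * s / v), (tendsto_log_natCast hp).eventually_gt_atTop 0,
    eventually_mul_log_le hp hKpos hK2 hs (by positivity : 0 < v / 8),
    eventually_mul_log_le hp hKpos hK2 hs (by positivity : 0 < κ / 2 / 16),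
    eventually_mul_lt_of_isLittleO hqC hlog1
      ((eventually_gt_atTop 0).mono fun n hn => Nat.cast_pos.mpr hn)]
    with n hn hXn hγ hηb hη4 hsign hτn hKn hmis hCn hL hKv hKκ hqCn
  have hP₁ := measure_exists_inner_gt_le hσ (h_indep n) (h_subG n) hn (norm_cols_sq hn hXn)
    (mul_pos (hτ n) (h_lam n))
  rw [mul_pow, ← mul_assoc (n : ℝ) (τ n ^ 2)] at hP₁
  have hP₂ := measure_exists_nonempty_projection_gt_le hσ (h_indep n) (h_subG n)
    (fun D => extraSpan (cols (X n)) (supp (βstar n)) (supp (βstar n) ∪ D))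
    (fun D => (finrank_extraSpan_le _ Finset.subset_union_left).trans
      (Finset.card_le_card (by rw [Finset.union_sdiff_left]; exact Finset.sdiff_subset)))
    (3 * Real.log (p n))
  have hP₃ := measure_exists_projection_gt_le hσ (h_indep n) (h_subG n)
    (fun D => meanSpan (cols (X n)) (fit (cols (X n)) (βstar n)) D)
    (fun D => finrank_meanSpan_le _ _ D) (3 * Real.log (p n))
  have hP₄ := measure_noise_norm_sq_le hv hn (h_indep n) (h_subG n) (h_mean n) (h_var n)
  refine le_trans ?_ (add_le_add (add_le_add (add_le_add hP₁ hP₂) hP₃) hP₄)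
  refine le_trans (measure_mono ?_) ((measure_union_le _ _).trans (add_le_add_left
    ((measure_union_le _ _).trans (add_le_add_left (measure_union_le _ _) _)) _))
  intro ω hω
  by_contra hgood
  rw [Set.mem_union, Set.mem_union, Set.mem_union, not_or, not_or, not_or] at hgood
  obtain ⟨⟨⟨g₁, g₂⟩, g₃⟩, g₄⟩ := hgood
  simp only [Set.mem_ofPred_eq, not_exists, not_and, not_lt] at g₁ g₂ g₃
  obtain ⟨g₄, g₅⟩ := of_not_not g₄
  obtain ⟨hsupp, hsse⟩ := path_oracle hA3 hn hXn hγ (h_lam n) (hτ n) hτn hηb hη4 hsign (hy n ω) g₁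
    (h_path n ω)
  refine hω (hbic_selects_of_events hn (hy n ω) (h_lam n) hsupp hsse hKn ?_ ?_ g₄ g₅ hmis hs hv
    (by positivity) hL hKv hKκ hCn hqCn)
  · intro D hD
    refine (g₂ D hD).trans (le_of_eq ?_)
    rw [hs_def]; ring
  · intro D
    refine (g₃ D).trans (le_of_eq ?_)
    rw [hs_def]; ring
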